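/- Let $r \ge 1$. Over the base field $\mathbb{R}$, let $U(r;\mathbb{A}^2) \subset (\mathbb{A}^2)^r$ be the open subscheme of $r$-tuples $((x_1,y_1),\dots,(x_r,y_r))$ with $x_k \neq y_k$ for at least one $k$, i.e. the complement of the closed subscheme defined by the ideal $(x_1-y_1,\dots,x_r-y_r)$. Let the symmetric group $S_2$ act on it by interchanging $x_k$ and $y_k$ for all $k$ simultaneously, and let $B(r;\mathbb{A}^2) = U(r;\mathbb{A}^2)/S_2$ be the quotient scheme. Let $S = \mathbb{R}[z_1,\dots,z_r]/(\sum_{i=1}^r z_i^2 - 1)$ with the $C_2$-action $z_i \mapsto -z_i$, let $R = S^{C_2}$, and let $Y(r) = \operatorname{Spec} R$. The equivariant morphism $\operatorname{Spec} S \to U(r;\mathbb{A}^2)$ given by $x_k = z_k/2$, $y_k = -z_k/2$ (that is, $x_k - y_k = z_k$ and $x_k + y_k = 0$) induces on quotients a morphism $Y(r) \to B(r;\mathbb{A}^2)$. For a scheme $X$ of finite type over $\mathbb{R}$, let $X(\mathbb{R})$ denote the space of $\operatorname{Gal}(\mathbb{C}/\mathbb{R})$-fixed points of $X(\mathbb{C})$,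 with the topology induced by the analytic topology of $X(\mathbb{C})$. Then: 1. The real manifold $B(r;\mathbb{A}^2)(\mathbb{R})$ is homotopy equivalent to $\mathbb{R}P^{r-1} \amalg \mathbb{R}P^{r-1}$, and it has exactly two connected components. 2. The morphism $Y(r) \to B(r;\mathbb{A}^2)$ is a closed immersion, $Y(r)(\mathbb{R})$ is homeomorphic to $\mathbb{R}P^{r-1}$, and the induced map $Y(r)(\mathbb{R}) \to B(r;\mathbb{A}^2)(\mathbb{R})$ is a closed embedding whose image is contained in one of the two connected components and is a (strong) deformation retract of that component. -/

import Mathlib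

open CategoryTheory AlgebraicGeometry
open scoped Pointwise

noncomputable section

namespace EtaleClassifying

/-! ### The quotient scheme `B(r; 𝔸ⁿ)` over `ℝ` -/

/-- The coordinate ring `ℝ[x_{ki}]` of `(𝔸ⁿ)^r`, with `k : Fin r` and `i : Fin n`. -/
abbrev CoordRing (r n : ℕ) : Type := MvPolynomial (Fin r × Fin n) ℝ

/-- The symmetric group permutes the `n` coordinates in all `r` factors simultaneously:
`σ • x_{ki} = x_{k,σ(i)}`. -/
instance permAction (r n : ℕ) : MulSemiringAction (Equiv.Perm (Fin n)) (CoordRing r n) where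
  smul σ p := MvPolynomial.rename (Prod.map id σ) p
  one_smul p := by
    change MvPolynomial.rename (Prod.map id id) p = p
    simp
  mul_smul σ τ p := by
    change MvPolynomial.rename _ p = MvPolynomial.rename _ (MvPolynomial.rename _ p)
    rw [MvPolynomial.rename_rename]
    rfl
  smul_zero σ := map_zero (MvPolynomial.rename (Prod.map id σ))
  smul_add σ := map_add (MvPolynomial.rename (Prod.map id σ))
  smul_one σ := map_one (MvPolynomial.rename (Prod.map id σ))
  smul_mul σ := map_mul (MvPolynomial.rename (Prod.map id σ))

theorem perm_smul_def {r n : ℕ} (σ : Equiv.Perm (Fin n)) (p : CoordRing r n) :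
    σ • p = MvPolynomial.rename (Prod.map id σ) p := rfl

instance permAction_smulComm (r n : ℕ) :
    SMulCommClass (Equiv.Perm (Fin n)) ℝ (CoordRing r n) where
  smul_comm σ c p := map_smul (MvPolynomial.rename (Prod.map id σ)) c p

/-- The ring of invariants `ℝ[x_{ki}]^{S_n}`. -/
abbrev Invariants (r n : ℕ) : Subalgebra ℝ (CoordRing r n) :=
  FixedPoints.subalgebra ℝ (CoordRing r n) (Equiv.Perm (Fin n))

/-- The closed set `Z_{ij} ⊆ (𝔸ⁿ)^r` cut out by the ideal `(x_{ki} - x_{kj} : k)`. -/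
def Zlocus (r n : ℕ) (i j : Fin n) : Set (PrimeSpectrum (CoordRing r n)) :=
  PrimeSpectrum.zeroLocus
    (Set.range fun k : Fin r => (MvPolynomial.X (k, i) - MvPolynomial.X (k, j) : CoordRing r n))

/-- The underlying set of `U(r; 𝔸ⁿ) = (𝔸ⁿ)^r - ⋃_{i < j} Z_{ij}`. -/
def Uset (r n : ℕ) : Set (PrimeSpectrum (CoordRing r n)) :=
  (⋃ (i : Fin n) (j : Fin n) (_ : i < j), Zlocus r n i j)ᶜ

/-- The quotient morphism `(𝔸ⁿ)^r → (𝔸ⁿ)^r / S_n = Spec (ℝ[x_{ki}]^{S_n})`. -/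
def quotMap (r n : ℕ) :
    Spec (CommRingCat.of (CoordRing r n)) ⟶ Spec (CommRingCat.of (Invariants r n)) :=
  Spec.map (CommRingCat.ofHom (algebraMap (Invariants r n) (CoordRing r n)))

instance invariants_isInvariant (r n : ℕ) :
    Algebra.IsInvariant (Invariants r n) (CoordRing r n) (Equiv.Perm (Fin n)) where
  isInvariant b hb := ⟨⟨b, hb⟩, rfl⟩

theorem mem_Uset {r n : ℕ} (p : PrimeSpectrum (CoordRing r n)) :
    p ∈ Uset r n ↔ ∀ i j : Fin n, i < j →
      ∃ k : Fin r, (MvPolynomial.X (k, i) - MvPolynomial.X (k, j) : CoordRing r n) ∉ p.asIdeal := by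
  simp [Uset, Zlocus, PrimeSpectrum.mem_zeroLocus, Set.range_subset_iff]

theorem isOpen_Uset (r n : ℕ) : IsOpen (Uset r n) := by
  rw [Uset, isOpen_compl_iff]
  refine isClosed_iUnion_of_finite fun i => isClosed_iUnion_of_finite fun j =>
    isClosed_iUnion_of_finite fun _ => PrimeSpectrum.isClosed_zeroLocus _

/-- The open subscheme `U(r; 𝔸ⁿ)` of `(𝔸ⁿ)^r`. -/
def U (r n : ℕ) : (Spec (CommRingCat.of (CoordRing r n))).Opens :=
  ⟨Uset r n, isOpen_Uset r n⟩

/-- `U(r; 𝔸ⁿ)` is stable under the symmetric group. -/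
theorem Uset_of_smul {r n : ℕ} {p q : PrimeSpectrum (CoordRing r n)} (σ : Equiv.Perm (Fin n))
    (h : q.asIdeal = σ • p.asIdeal) (hp : p ∈ Uset r n) : q ∈ Uset r n := by
  rw [mem_Uset] at hp ⊢
  have key : ∀ i j : Fin n, i ≠ j →
      ∃ k : Fin r, (MvPolynomial.X (k, i) - MvPolynomial.X (k, j) : CoordRing r n) ∉ p.asIdeal := by
    intro i j hij
    rcases lt_or_gt_of_ne hij with h1 | h1
    · exact hp i j h1
    · obtain ⟨k, hk⟩ := hp j i h1
      refine ⟨k, fun h2 => hk ?_⟩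
      rw [← neg_sub]
      exact neg_mem h2
  intro i j hij
  obtain ⟨k, hk⟩ := key (σ⁻¹ i) (σ⁻¹ j) (fun e => hij.ne (σ⁻¹.injective e))
  refine ⟨k, fun h2 => hk ?_⟩
  rw [h, Ideal.mem_pointwise_smul_iff_inv_smul_mem, perm_smul_def] at h2
  simpa using h2

/-- The image of `U(r; 𝔸ⁿ)` in `(𝔸ⁿ)^r / S_n` is open. -/
theorem isOpen_image_Uset (r n : ℕ) :
    IsOpen (PrimeSpectrum.comap (algebraMap (Invariants r n) (CoordRing r n)) '' Uset r n) := by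
  have hint : Algebra.IsIntegral (Invariants r n) (CoordRing r n) :=
    Algebra.IsInvariant.isIntegral (Invariants r n) (CoordRing r n) (Equiv.Perm (Fin n))
  have hint' : (algebraMap (Invariants r n) (CoordRing r n)).IsIntegral :=
    algebraMap_isIntegral_iff.mpr hint
  have hsurj : Function.Surjective
      (PrimeSpectrum.comap (algebraMap (Invariants r n) (CoordRing r n))) := by
    intro P
    obtain ⟨Q, -, hQ, hQP⟩ := Ideal.exists_ideal_over_prime_of_isIntegral
      (S := CoordRing r n) P.asIdeal ⊥ (by
        intro x hx
        have hx0 : algebraMap (Invariants r n) (CoordRing r n) x = 0 := by simpa using hx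
        have hx1 : x = 0 := Subtype.ext hx0
        rw [hx1]
        exact P.asIdeal.zero_mem)
    exact ⟨⟨Q, hQ⟩, PrimeSpectrum.ext hQP⟩
  have hcl : IsClosedMap (PrimeSpectrum.comap (algebraMap (Invariants r n) (CoordRing r n))) :=
    PrimeSpectrum.isClosedMap_comap_of_isIntegral _ hint'
  have h := hcl _ (isOpen_Uset r n).isClosed_compl
  rw [← isOpen_compl_iff] at h
  convert h using 1
  ext y
  constructor
  · rintro ⟨p, hp, rfl⟩ ⟨q, hq, hqp⟩
    have hu : q.asIdeal.under (Invariants r n) = p.asIdeal.under (Invariants r n) :=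
      congrArg PrimeSpectrum.asIdeal hqp
    obtain ⟨σ, hσ⟩ := Algebra.IsInvariant.exists_smul_of_under_eq
      (Invariants r n) (CoordRing r n) (Equiv.Perm (Fin n)) p.asIdeal q.asIdeal hu.symm
    exact hq (Uset_of_smul σ hσ hp)
  · intro hy
    obtain ⟨p, rfl⟩ := hsurj y
    refine ⟨p, ?_, rfl⟩
    by_contra hp
    exact hy ⟨p, hp, rfl⟩

/-- `U(r; 𝔸ⁿ) / S_n` as an open subset of `(𝔸ⁿ)^r / S_n`: the image of `U(r; 𝔸ⁿ)`. -/
def BOpens (r n : ℕ) : (Spec (CommRingCat.of (Invariants r n))).Opens :=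
  ⟨quotMap r n '' (U r n : Set (Spec (CommRingCat.of (CoordRing r n)))), isOpen_image_Uset r n⟩

/-- The base scheme `Spec ℝ`. -/
abbrev SpecR : Scheme.{0} := Spec (CommRingCat.of ℝ)

/-- The real scheme `B(r; 𝔸ⁿ) = U(r; 𝔸ⁿ) / S_n`. As `U(r; 𝔸ⁿ)` is an `S_n`-stable open subscheme
of the affine scheme `(𝔸ⁿ)^r`, its quotient is the open image of `U(r; 𝔸ⁿ)` in the spectrum of the
ring of invariants. -/
def B (r n : ℕ) : Over SpecR :=
  Over.mk ((BOpens r n).ι ≫ Spec.map (CommRingCat.ofHom (algebraMap ℝ (Invariants r n))))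

/-! ### The scheme `Y(r)` and its inclusion in `B(r; 𝔸²)` -/

/-- The ring `S = ℝ[z_1, …, z_r] / (∑ z_i² - 1)`. -/
def SRing (r : ℕ) : Type :=
  MvPolynomial (Fin r) ℝ ⧸
    Ideal.span {(∑ i : Fin r, MvPolynomial.X i ^ 2 - 1 : MvPolynomial (Fin r) ℝ)}

instance (r : ℕ) : CommRing (SRing r) :=
  inferInstanceAs (CommRing (MvPolynomial (Fin r) ℝ ⧸
    Ideal.span {(∑ i : Fin r, MvPolynomial.X i ^ 2 - 1 : MvPolynomial (Fin r) ℝ)}))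

instance (r : ℕ) : Algebra ℝ (SRing r) :=
  inferInstanceAs (Algebra ℝ (MvPolynomial (Fin r) ℝ ⧸
    Ideal.span {(∑ i : Fin r, MvPolynomial.X i ^ 2 - 1 : MvPolynomial (Fin r) ℝ)}))

/-- The quotient map `ℝ[z_1, …, z_r] → S`. -/
def toS (r : ℕ) : MvPolynomial (Fin r) ℝ →ₐ[ℝ] SRing r :=
  Ideal.Quotient.mkₐ ℝ _

/-- The class of the coordinate `z_i` in `S`. -/
def z {r : ℕ} (i : Fin r) : SRing r :=
  toS r (MvPolynomial.X i)

theorem sum_z_sq (r : ℕ) : ∑ i : Fin r, (z i : SRing r) ^ 2 = 1 := by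
  have h : toS r (∑ i : Fin r, MvPolynomial.X i ^ 2 - 1) = 0 :=
    Ideal.Quotient.eq_zero_iff_mem.mpr (Ideal.subset_span rfl)
  rw [map_sub, map_sum, map_one, sub_eq_zero] at h
  simpa [z] using h

/-- The generator of the `C₂`-action on `S`: the `ℝ`-algebra endomorphism `z_i ↦ -z_i`. -/
def negS (r : ℕ) : SRing r →ₐ[ℝ] SRing r :=
  Ideal.Quotient.liftₐ
    (Ideal.span {(∑ i : Fin r, MvPolynomial.X i ^ 2 - 1 : MvPolynomial (Fin r) ℝ)})
    (MvPolynomial.aeval fun i : Fin r => -(z i : SRing r)) (by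
    intro a ha
    have hle : Ideal.span {(∑ i : Fin r, MvPolynomial.X i ^ 2 - 1 : MvPolynomial (Fin r) ℝ)} ≤
        RingHom.ker (MvPolynomial.aeval fun i : Fin r => -(z i : SRing r)) := by
      rw [Ideal.span_singleton_le_iff_mem, RingHom.mem_ker]
      simp [sum_z_sq]
    exact hle ha)

theorem negS_z {r : ℕ} (i : Fin r) : negS r (z i) = -z i :=
  MvPolynomial.aeval_X _ i

theorem SRing_hom_ext {r : ℕ} {T : Type} [CommRing T] [Algebra ℝ T] {f g : SRing r →ₐ[ℝ] T}
    (h : ∀ i, f (z i) = g (z i)) : f = g := by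
  have h2 : f.comp (toS r) = g.comp (toS r) := MvPolynomial.algHom_ext h
  ext s
  obtain ⟨p, rfl⟩ := Ideal.Quotient.mk_surjective s
  exact DFunLike.congr_fun h2 p

theorem negS_negS {r : ℕ} (s : SRing r) : negS r (negS r s) = s := by
  have h : (negS r).comp (negS r) = AlgHom.id ℝ (SRing r) :=
    SRing_hom_ext fun i => by simp [negS_z]
  exact DFunLike.congr_fun h s

/-- The ring of invariants `R = S^{C₂}`. -/
abbrev RRing (r : ℕ) : Subalgebra ℝ (SRing r) :=
  AlgHom.equalizer (negS r) (AlgHom.id ℝ (SRing r))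

/-- The real scheme `Y(r) = Spec R`. -/
def Y (r : ℕ) : Over SpecR :=
  Over.mk (Spec.map (CommRingCat.ofHom (algebraMap ℝ (RRing r))))

/-- The ring map dual to `P(r) = Spec S → (𝔸²)^r`. In the coordinates `z_k = x_{k0} - x_{k1}` and
`w_k = x_{k0} + x_{k1}` it is the inclusion `(z_1, …, z_r) ↦ (z_1, …, z_r, 0, …, 0)`, that is,
`x_{k0} = z_k / 2` and `x_{k1} = - z_k / 2`. -/
def coordToS (r : ℕ) : CoordRing r 2 →ₐ[ℝ] SRing r :=
  MvPolynomial.aeval fun ki : Fin r × Fin 2 =>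
    if ki.2 = 0 then (1 / 2 : ℝ) • z ki.1 else -((1 / 2 : ℝ) • z ki.1)

/-- The map `P(r) → (𝔸²)^r` is equivariant. -/
theorem negS_coordToS {r : ℕ} (p : CoordRing r 2) :
    negS r (coordToS r p) = coordToS r (Equiv.swap (0 : Fin 2) 1 • p) := by
  have h : (negS r).comp (coordToS r) =
      (coordToS r).comp (MvPolynomial.rename (Prod.map id (Equiv.swap (0 : Fin 2) 1))) := by
    refine MvPolynomial.algHom_ext fun ki => ?_
    obtain ⟨k, i⟩ := ki
    fin_cases i <;> simp [coordToS, negS_z]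
  exact DFunLike.congr_fun h p

/-- The induced ring map on invariants, dual to `Y(r) → (𝔸²)^r / S_2`. -/
def invToR (r : ℕ) : Invariants r 2 →ₐ[ℝ] RRing r :=
  ((coordToS r).comp (Invariants r 2).val).codRestrict (RRing r) fun p => by
    change negS r (coordToS r p.1) = coordToS r p.1
    rw [negS_coordToS, p.2]

theorem isIntegral_RRing (r : ℕ) : (algebraMap (RRing r) (SRing r)).IsIntegral := by
  intro s
  have h1 : s + negS r s ∈ RRing r := by
    change negS r (s + negS r s) = s + negS r s
    rw [map_add, negS_negS, add_comm]
  have h2 : s * negS r s ∈ RRing r := by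
    change negS r (s * negS r s) = s * negS r s
    rw [map_mul, negS_negS, mul_comm]
  refine ⟨Polynomial.X ^ 2 + (Polynomial.C (-(⟨_, h1⟩ : RRing r)) * Polynomial.X +
    Polynomial.C (⟨_, h2⟩ : RRing r)), ?_, ?_⟩
  · apply Polynomial.monic_X_pow_add
    exact lt_of_le_of_lt Polynomial.degree_linear_le (by norm_num)
  · rw [Polynomial.eval₂_add, Polynomial.eval₂_add, Polynomial.eval₂_mul, Polynomial.eval₂_pow,
      Polynomial.eval₂_X, Polynomial.eval₂_C, Polynomial.eval₂_C]
    change s ^ 2 + (-(s + negS r s) * s + s * negS r s) = 0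
    ring

/-- The morphism `Y(r) → (𝔸²)^r / S_2`. -/
def YToQuot (r : ℕ) :
    Spec (CommRingCat.of (RRing r)) ⟶ Spec (CommRingCat.of (Invariants r 2)) :=
  Spec.map (CommRingCat.ofHom (invToR r).toRingHom)

/-- The morphism `Y(r) → (𝔸²)^r / S_2` lands in `B(r; 𝔸²)`. -/
theorem YToQuot_range (r : ℕ) :
    Set.range (YToQuot r) ⊆ Set.range (BOpens r 2).ι := by
  rw [Scheme.Opens.range_ι]
  rintro _ ⟨(y : PrimeSpectrum (RRing r)), rfl⟩
  have hRS : Algebra.IsIntegral (RRing r) (SRing r) :=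
    algebraMap_isIntegral_iff.mp (isIntegral_RRing r)
  obtain ⟨Q, -, hQ, hQy⟩ := Ideal.exists_ideal_over_prime_of_isIntegral
    (S := SRing r) y.asIdeal ⊥ (by
      intro x hx
      have hx0 : algebraMap (RRing r) (SRing r) x = 0 := by simpa using hx
      have hx1 : x = 0 := Subtype.ext hx0
      rw [hx1]
      exact y.asIdeal.zero_mem)
  refine ⟨PrimeSpectrum.comap (coordToS r).toRingHom ⟨Q, hQ⟩, ?_, ?_⟩
  · refine (mem_Uset _).mpr fun i j hij => ?_
    by_contra! hall
    have hi : i = 0 := by omega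
    have hj : j = 1 := by omega
    subst hi hj
    apply hQ.ne_top
    rw [Ideal.eq_top_iff_one, ← sum_z_sq r]
    refine Ideal.sum_mem _ fun k _ => ?_
    have hk : coordToS r (MvPolynomial.X (k, 0) - MvPolynomial.X (k, 1)) ∈ Q := hall k
    have hz : coordToS r (MvPolynomial.X (k, 0) - MvPolynomial.X (k, 1)) = z k := by
      simp only [coordToS, map_sub, MvPolynomial.aeval_X]
      simp only [if_true, one_ne_zero, if_false, sub_neg_eq_add, ← add_smul]
      norm_num
    rw [hz] at hk
    exact Ideal.pow_mem_of_mem Q hk 2 (by norm_num)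
  · apply PrimeSpectrum.ext
    ext p
    have h := SetLike.ext_iff.mp hQy (invToR r p)
    exact h

/-- The morphism of schemes underlying `Y(r) → B(r; 𝔸²)`. -/
def YToBScheme (r : ℕ) : Spec (CommRingCat.of (RRing r)) ⟶ (BOpens r 2).toScheme :=
  IsOpenImmersion.lift (BOpens r 2).ι (YToQuot r) (YToQuot_range r)

theorem YToBScheme_over (r : ℕ) :
    YToBScheme r ≫ (BOpens r 2).ι ≫
      Spec.map (CommRingCat.ofHom (algebraMap ℝ (Invariants r 2))) =
      Spec.map (CommRingCat.ofHom (algebraMap ℝ (RRing r))) := by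
  rw [YToBScheme, IsOpenImmersion.lift_fac_assoc, YToQuot, ← Spec.map_comp,
    ← CommRingCat.ofHom_comp]
  congr 2
  ext c
  exact congrArg Subtype.val ((invToR r).commutes c)

/-- The morphism `Y(r) → B(r; 𝔸²)` of real schemes. -/
def YToB (r : ℕ) : Y r ⟶ B r 2 :=
  Over.homMk (YToBScheme r) (YToBScheme_over r)

/-! ### Complex and real points with the analytic topology -/

/-- `Spec ℂ` as a real scheme. -/
def SpecC : Over SpecR :=
  Over.mk (Spec.map (CommRingCat.ofHom (algebraMap ℝ ℂ)))

/-- Complex conjugation on `Spec ℂ`. -/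
def conj : SpecC ⟶ SpecC :=
  Over.homMk (Spec.map (CommRingCat.ofHom (starRingEnd ℂ))) (by
    change Spec.map _ ≫ Spec.map _ = Spec.map _
    rw [← Spec.map_comp, ← CommRingCat.ofHom_comp]
    congr 2
    ext c
    exact Complex.conj_ofReal c)

/-- The set `X(ℂ)` of complex points of a real scheme `X`, that is, of `ℂ`-points of `X_ℂ`. -/
def ComplexPoints (X : Over SpecR) : Type := SpecC ⟶ X

/-- The value `f(x) ∈ ℂ` at a complex point `x` lying in the open subscheme `V` of a regular
function `f` on `V`. -/
def ComplexPoints.eval {X : Over SpecR} (x : ComplexPoints X) (V : X.left.Opens)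
    (h : ⊤ ≤ (Over.Hom.left x) ⁻¹ᵁ V) (f : Γ(X.left, V)) : ℂ :=
  (Scheme.ΓSpecIso (CommRingCat.of ℂ)).hom ((Over.Hom.left x).appLE V ⊤ h f)

/-- The analytic topology on `X(ℂ)`: the coarsest topology such that, for every Zariski open `V`,
the set `V(ℂ)` is open and every regular function on `V` is continuous on `V(ℂ)`. -/
instance (X : Over SpecR) : TopologicalSpace (ComplexPoints X) :=
  TopologicalSpace.generateFrom
    {s | ∃ (V : X.left.Opens) (f : Γ(X.left, V)) (O : Set ℂ), IsOpen O ∧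
      s = {x : ComplexPoints X |
        ∃ h : ⊤ ≤ (Over.Hom.left x) ⁻¹ᵁ V, x.eval V h f ∈ O}}

/-- The action of complex conjugation on `X(ℂ)`. -/
def ComplexPoints.conjAct {X : Over SpecR} (x : ComplexPoints X) : ComplexPoints X :=
  conj ≫ (show SpecC ⟶ X from x)

/-- The space `X(ℝ)` of real points: the Galois-fixed points of `X(ℂ)`, with the subspace
topology. -/
def RealPoints (X : Over SpecR) : Type := {x : ComplexPoints X // x.conjAct = x}

instance (X : Over SpecR) : TopologicalSpace (RealPoints X) :=
  inferInstanceAs (TopologicalSpace {x : ComplexPoints X // x.conjAct = x})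

/-- The map `X(ℝ) → X'(ℝ)` induced by a morphism `X → X'` of real schemes. -/
def RealPoints.map {X X' : Over SpecR} (f : X ⟶ X') (x : RealPoints X) : RealPoints X' :=
  ⟨(show SpecC ⟶ X from x.1) ≫ f, by
    change conj ≫ (show SpecC ⟶ X from x.1) ≫ f = (show SpecC ⟶ X from x.1) ≫ f
    rw [← Category.assoc]
    exact congrArg (fun y : SpecC ⟶ X => y ≫ f) x.2⟩

/-! ### Topology -/

/-- The real projective space `ℝP^{r-1}` of lines in `ℝ^r`. -/
def RealProj (r : ℕ) : Type := Projectivization ℝ (Fin r → ℝ)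

/-- `ℝP^{r-1}` has the quotient topology of `ℝ^r \ {0}`. -/
instance (r : ℕ) : TopologicalSpace (RealProj r) :=
  inferInstanceAs (TopologicalSpace (Quotient (projectivizationSetoid ℝ (Fin r → ℝ))))

/-- The subset `A` is a (strong) deformation retract of the subspace `C` of `X`. -/
def IsDeformationRetract {X : Type} [TopologicalSpace X] (A C : Set X) : Prop :=
  A ⊆ C ∧ ∃ H : C(unitInterval × C, C),
    (∀ x, H (0, x) = x) ∧ (∀ x, (H (1, x) : X) ∈ A) ∧
      ∀ (t : unitInterval) (x : C), (x : X) ∈ A → H (t, x) = x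

end EtaleClassifying

end

noncomputable section

namespace EtaleClassifying

open Topology

/-! The ring of invariants is generated by the sums `w_k = x_{k0} + x_{k1}` and the products `M_{ij}
= d_i d_j` of the differences `d_k = x_{k0} - x_{k1}` (`adjoin_invGen`). A real point of `B(r; 𝔸²)`
is therefore a pair `(w, M)`. The relations `M_{ij} M_{kk} = M_{ik} M_{jk}`, together with some
`M_{kk} ≠ 0`, force `M = ε v vᵀ` with `v ≠ 0` and `ε = ±1` (`exists_bCoord_snd`). Conversely all
such pairs occur (`exists_bCoord_eq`): `ε = 1` comes from unordered pairs of distinct real points,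
`ε = -1` from `w` and an imaginary difference `i v`.

The trace of `M` never vanishes and its sign is `ε`, which splits the space into two clopen parts.
Each part is connected, since `v` may be replaced by `-v` and then joined to another vector by a
segment avoiding `0`. Shrinking `w` to `0` and scaling `M` to trace `±1` deforms each part onto the
matrices `± v vᵀ` with `|v| = 1`, which form a copy of `ℝP^{r-1}`. The locus `w = 0`, `tr M = 1` is
exactly the image of `Y(r)(ℝ)`.

These coordinates have to be matched with the analytic topology, which is defined through all
Zariski opens. That is the role of `SpecChart.isInducing_complexHom` and
`SpecChart.isInducing_of_adjoin`: on an open subscheme of `Spec A`, generators of `A` already induce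
the topology on real points. -/

/-! ### Values of regular functions at complex points of an affine scheme. -/

/-- Evaluation of sections over `V` at a morphism `Spec ℂ ⟶ Z` that factors through `V`. -/
def sectionVal {Z : Scheme.{0}} (q : Spec (CommRingCat.of ℂ) ⟶ Z) (V : Z.Opens)
    (h : ⊤ ≤ q ⁻¹ᵁ V) : Γ(Z, V) →+* ℂ :=
  (q.appLE V ⊤ h ≫ (Scheme.ΓSpecIso (CommRingCat.of ℂ)).hom).hom

theorem sectionVal_map {Z : Scheme.{0}} (q : Spec (CommRingCat.of ℂ) ⟶ Z) {V W : Z.Opens}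
    (h : ⊤ ≤ q ⁻¹ᵁ W) (i : W ≤ V) (f : Γ(Z, V)) :
    sectionVal q W h (Z.presheaf.map (homOfLE i).op f) =
      sectionVal q V (h.trans (q.preimage_mono i)) f := by
  have := q.map_appLE h (homOfLE i).op
  simp only [sectionVal, ← this]
  rfl

theorem sectionVal_comp {Z Z' : Scheme.{0}} (q : Spec (CommRingCat.of ℂ) ⟶ Z) (j : Z ⟶ Z')
    (W : Z'.Opens) (V : Z.Opens) (h : ⊤ ≤ q ⁻¹ᵁ V) (i : V ≤ j ⁻¹ᵁ W) (f : Γ(Z', W)) :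
    sectionVal q V h (j.appLE W V i f) = sectionVal (q ≫ j) W (h.trans (q.preimage_mono i)) f := by
  have := Scheme.Hom.appLE_comp_appLE q j W V ⊤ i h
  simp only [sectionVal, ← this]
  rfl

theorem sectionVal_Spec_top {A : CommRingCat.{0}} (φ : A ⟶ CommRingCat.of ℂ) (a : A) :
    sectionVal (Spec.map φ) ⊤ le_top ((Scheme.ΓSpecIso A).inv a) = φ a := by
  have h1 := Scheme.ΓSpecIso_naturality φ
  have h2 := congrArg (fun f => (Scheme.ΓSpecIso A).inv ≫ f) h1
  simp only [Iso.inv_hom_id_assoc] at h2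
  have h3 := congrArg (fun f => f.hom a) h2
  rw [← show _ = φ a from h3]
  simp only [sectionVal, Scheme.Hom.appTop, Scheme.Hom.app_eq_appLE]
  rfl

theorem sectionVal_Spec_algebraMap {A : CommRingCat.{0}} (φ : A ⟶ CommRingCat.of ℂ)
    (V : (Spec A).Opens) (h : ⊤ ≤ (Spec.map φ) ⁻¹ᵁ V) (a : A) :
    sectionVal (Spec.map φ) V h (algebraMap A Γ(Spec A, V) a) = φ a := by
  rw [IsAffineOpen.algebraMap_Spec_obj]
  exact (sectionVal_map (Spec.map φ) h le_top _).trans (sectionVal_Spec_top φ a)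

/-- Basic opens form a basis, and the sections over the basic open set of `a` are the localization
of `A` at `a`. A section is thus a single fraction near `p`, simultaneously for all complex points
at which the denominator does not vanish. -/
theorem exists_local_fraction {A : CommRingCat.{0}} (W : (Spec A).Opens)
    (g : Γ(Spec A, W)) (p : Spec A) (hp : p ∈ W) :
    ∃ (a b : A), a ∉ PrimeSpectrum.asIdeal p ∧ ∀ (φ : A ⟶ CommRingCat.of ℂ), φ a ≠ 0 →
      ∃ h : ⊤ ≤ (Spec.map φ) ⁻¹ᵁ W, sectionVal (Spec.map φ) W h g = φ b / φ a := by
  obtain ⟨_, ⟨_, ⟨a, rfl⟩, rfl⟩, hpa, haW⟩ :=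
    PrimeSpectrum.isBasis_basic_opens.exists_subset_of_mem_open hp W.isOpen
  let D : (Spec A).Opens := PrimeSpectrum.basicOpen a
  have hle : D ≤ W := haW
  have hloc : IsLocalization.Away a Γ(Spec A, D) :=
    StructureSheaf.IsLocalization.to_basicOpen A a
  obtain ⟨n, b, hb⟩ := IsLocalization.Away.surj (S := Γ(Spec A, D)) a
    ((Spec A).presheaf.map (homOfLE hle).op g)
  -- The extra factor `a` makes a nonzero denominator imply `φ a ≠ 0` even when `n = 0`.
  refine ⟨a ^ (n + 1), b * a, fun h => hpa (p.2.mem_of_pow_mem _ h), fun φ hφ => ?_⟩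
  rw [map_pow] at hφ
  have ha : φ a ≠ 0 := fun h => hφ (by rw [h]; simp)
  have hD : ⊤ ≤ (Spec.map φ) ⁻¹ᵁ D := by
    intro (y : PrimeSpectrum ℂ) _ hy
    have : φ a ∈ y.asIdeal := hy
    exact y.2.ne_top (Ideal.eq_top_of_isUnit_mem _ this (isUnit_iff_ne_zero.mpr ha))
  refine ⟨hD.trans (Scheme.Hom.preimage_mono _ hle), ?_⟩
  rw [← sectionVal_map _ hD hle]
  have h1 := congrArg (sectionVal (Spec.map φ) _ hD) hb
  rw [map_mul, map_pow, sectionVal_Spec_algebraMap, sectionVal_Spec_algebraMap] at h1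
  rw [map_pow, eq_div_iff hφ, map_mul, pow_succ, ← mul_assoc, h1]

/-! ### Complex and real points, and the homomorphisms they define. -/

/-- The real-valued algebra homomorphism underlying a conjugation-invariant complex-valued one. -/
def realify {A : Type} [CommRing A] [Algebra ℝ A] (φ : A →ₐ[ℝ] ℂ)
    (h : ∀ a, (starRingEnd ℂ) (φ a) = φ a) : A →ₐ[ℝ] ℝ :=
  AlgHom.ofLinearMap (Complex.reLm ∘ₗ φ.toLinearMap) (by simp) fun a b => by
    have ha := Complex.conj_eq_iff_im.mp (h a)
    simp [ha]

theorem coe_realify {A : Type} [CommRing A] [Algebra ℝ A] (φ : A →ₐ[ℝ] ℂ)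
    (h : ∀ a, (starRingEnd ℂ) (φ a) = φ a) (a : A) : (realify φ h a : ℂ) = φ a :=
  Complex.conj_eq_iff_re.mp (h a)

/-- The point of `Spec ℂ`. -/
def pointC : Spec (CommRingCat.of ℂ) := IsLocalRing.closedPoint ℂ

/-- The morphism of schemes underlying a complex point. -/
def ComplexPoints.left {X : Over SpecR} (x : ComplexPoints X) :
    Spec (CommRingCat.of ℂ) ⟶ X.left :=
  Over.Hom.left (show SpecC ⟶ X from x)

theorem ComplexPoints.left_injective {X : Over SpecR} :
    Function.Injective (ComplexPoints.left (X := X)) :=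
  fun _ _ h => Over.OverMorphism.ext h

theorem ComplexPoints.left_conjAct {X : Over SpecR} (x : ComplexPoints X) :
    x.conjAct.left = Spec.map (CommRingCat.ofHom (starRingEnd ℂ)) ≫ x.left := rfl

/-- The complex point underlying a real point. -/
def RealPoints.toComplex {X : Over SpecR} (x : RealPoints X) : ComplexPoints X :=
  Subtype.val (p := fun x : ComplexPoints X => x.conjAct = x) x

theorem RealPoints.conjAct_toComplex {X : Over SpecR} (x : RealPoints X) :
    x.toComplex.conjAct = x.toComplex :=
  Subtype.property (p := fun x : ComplexPoints X => x.conjAct = x) x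

theorem RealPoints.isInducing_toComplex {X : Over SpecR} :
    IsInducing (RealPoints.toComplex (X := X)) :=
  IsInducing.subtypeVal (t := {x : ComplexPoints X | x.conjAct = x})

theorem RealPoints.toComplex_injective {X : Over SpecR} :
    Function.Injective (RealPoints.toComplex (X := X)) :=
  Subtype.val_injective (p := fun x : ComplexPoints X => x.conjAct = x)

theorem RealPoints.left_map {X X' : Over SpecR} (f : X ⟶ X') (x : RealPoints X) :
    (RealPoints.map f x).toComplex.left = x.toComplex.left ≫ Over.Hom.left f := rfl

/-! ### Points of open subschemes of an affine scheme. -/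

/-- An open immersion over `ℝ` of a real scheme into the spectrum of an `ℝ`-algebra. -/
structure SpecChart (X : Over SpecR) (A : Type) [CommRing A] [Algebra ℝ A] where
  /-- The open immersion. -/
  hom : X.left ⟶ Spec (CommRingCat.of A)
  isOpenImmersion : IsOpenImmersion hom
  comp_structure : hom ≫ Spec.map (CommRingCat.ofHom (algebraMap ℝ A)) = X.hom

/-- The point of `Spec A` at which an algebra homomorphism `A → ℝ` is supported. -/
def kerPoint {A : Type} [CommRing A] [Algebra ℝ A] (φ : A →ₐ[ℝ] ℝ) : PrimeSpectrum A :=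
  ⟨RingHom.ker φ, RingHom.ker_isPrime φ⟩

namespace SpecChart

variable {X : Over SpecR} {A : Type} [CommRing A] [Algebra ℝ A] (c : SpecChart X A)

/-- The algebra homomorphism `a ↦ a(x)` attached to a complex point `x`. -/
def complexHom (x : ComplexPoints X) : A →ₐ[ℝ] ℂ where
  __ := (Spec.preimage (x.left ≫ c.hom)).hom
  commutes' t := by
    have h1 : x.left ≫ X.hom = SpecC.hom := Over.w (show SpecC ⟶ X from x)
    have h2 : Spec.map (CommRingCat.ofHom (algebraMap ℝ A) ≫
        Spec.preimage (x.left ≫ c.hom)) =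
        Spec.map (CommRingCat.ofHom (algebraMap ℝ ℂ)) := by
      rw [Spec.map_comp, Spec.map_preimage, Category.assoc, c.comp_structure, h1]
      rfl
    exact congrArg (fun f => f.hom t) (Spec.map_injective h2)

theorem Spec_map_complexHom (x : ComplexPoints X) :
    Spec.map (CommRingCat.ofHom (c.complexHom x).toRingHom) = x.left ≫ c.hom :=
  Spec.map_preimage _

theorem complexHom_injective : Function.Injective c.complexHom := by
  intro x y h
  have := c.isOpenImmersion
  have h1 := c.Spec_map_complexHom x
  rw [h, c.Spec_map_complexHom y] at h1
  exact ComplexPoints.left_injective ((cancel_mono c.hom).mp h1).symm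

theorem exists_complexHom (φ : A →ₐ[ℝ] ℂ)
    (h : Set.range (Spec.map (CommRingCat.ofHom φ.toRingHom)) ⊆ Set.range c.hom) :
    ∃ x, c.complexHom x = φ := by
  have := c.isOpenImmersion
  let f := IsOpenImmersion.lift c.hom (Spec.map (CommRingCat.ofHom φ.toRingHom)) h
  have hf : f ≫ c.hom = Spec.map (CommRingCat.ofHom φ.toRingHom) := IsOpenImmersion.lift_fac _ _ _
  have hw : f ≫ X.hom = SpecC.hom := by
    rw [← c.comp_structure, ← Category.assoc, hf, ← Spec.map_comp, ← CommRingCat.ofHom_comp]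
    exact congrArg (fun f => Spec.map (CommRingCat.ofHom f)) φ.comp_algebraMap
  let x : ComplexPoints X := (Over.homMk f hw : SpecC ⟶ X)
  refine ⟨x, ?_⟩
  have h1 := (c.Spec_map_complexHom x).trans hf
  have h2 := Spec.map_injective h1
  ext a
  exact congrArg (fun f => f.hom a) h2

theorem complexHom_conjAct (x : ComplexPoints X) (a : A) :
    c.complexHom x.conjAct a = (starRingEnd ℂ) (c.complexHom x a) := by
  have h1 : Spec.map (CommRingCat.ofHom (c.complexHom x.conjAct).toRingHom) =
      Spec.map (CommRingCat.ofHom (c.complexHom x).toRingHom ≫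
        CommRingCat.ofHom (starRingEnd ℂ)) := by
    rw [Spec.map_comp, c.Spec_map_complexHom, c.Spec_map_complexHom, x.left_conjAct, Category.assoc]
  exact congrArg (fun f => f.hom a) (Spec.map_injective h1)

theorem complexHom_eq_eval (x : ComplexPoints X) (a : A) :
    c.complexHom x a = x.eval ⊤ le_top
      (c.hom.appLE ⊤ ⊤ le_top ((Scheme.ΓSpecIso (CommRingCat.of A)).inv a)) := by
  have h1 := sectionVal_comp x.left c.hom ⊤ ⊤ le_top le_top
    ((Scheme.ΓSpecIso (CommRingCat.of A)).inv a)
  refine Eq.trans ?_ h1.symm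
  have h2 := sectionVal_Spec_top (CommRingCat.ofHom (c.complexHom x).toRingHom) a
  refine (show c.complexHom x a = _ from h2.symm).trans ?_
  simp only [c.Spec_map_complexHom]

/-- Global functions from `A` suffice although the topology is defined by sections over all opens:
near a given point any section is a quotient `b / a` of elements of `A`, and division is continuous
where `a` does not vanish. -/
theorem isInducing_complexHom :
    IsInducing (fun (x : ComplexPoints X) (a : A) => c.complexHom x a) := by
  have := c.isOpenImmersion
  refine ⟨le_antisymm ?_ ?_⟩
  · rw [← continuous_iff_le_induced]
    refine continuous_pi fun a => ⟨fun O hO => ?_⟩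
    refine TopologicalSpace.isOpen_generateFrom_of_mem ⟨⊤,
      c.hom.appLE ⊤ ⊤ le_top ((Scheme.ΓSpecIso (CommRingCat.of A)).inv a), O, hO, ?_⟩
    ext x
    simp only [Set.mem_preimage, c.complexHom_eq_eval, Set.mem_ofPred_eq]
    exact ⟨fun h => ⟨le_top, h⟩, fun ⟨_, h⟩ => h⟩
  · refine le_generateFrom ?_
    rintro _ ⟨V, f, O, hO, rfl⟩
    let τ := TopologicalSpace.induced (fun (x : ComplexPoints X) (a : A) => c.complexHom x a)
      inferInstance
    have hcont : ∀ a : A, Continuous[τ, _] fun x => c.complexHom x a := fun a =>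
      (continuous_apply a).comp continuous_induced_dom
    rw [isOpen_iff_forall_mem_open]
    rintro x ⟨hx, hxO⟩
    -- Transport `V` and `f` along the open immersion into `Spec A`, where local fractions are
    -- available.
    let W := c.hom ''ᵁ V
    have hV : V ≤ c.hom ⁻¹ᵁ W := (c.hom.preimage_image_eq V).ge
    let g := (c.hom.appIso V).inv f
    have hg : c.hom.appLE W V hV g = f := by
      have := Scheme.Hom.appIso_inv_appLE c.hom (U := V) (V := V) hV
      have h2 := congrArg (fun k => k.hom f) this
      exact h2.trans (by simp)
    have hpt : (x.left ≫ c.hom) pointC ∈ W :=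
      ⟨_, hx (Set.mem_univ pointC), rfl⟩
    obtain ⟨a, b, ha, hab⟩ := exists_local_fraction W g _ hpt
    have hval : ∀ y : ComplexPoints X, c.complexHom y a ≠ 0 →
        ∃ h : ⊤ ≤ y.left ⁻¹ᵁ V, y.eval V h f = c.complexHom y b / c.complexHom y a := by
      intro y hy
      obtain ⟨h, h'⟩ := hab (CommRingCat.ofHom (c.complexHom y).toRingHom) hy
      have hyV : ⊤ ≤ y.left ⁻¹ᵁ V := by
        have h2 := h
        rw [c.Spec_map_complexHom, Scheme.Hom.comp_preimage, c.hom.preimage_image_eq] at h2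
        exact h2
      refine ⟨hyV, ?_⟩
      have h3 := sectionVal_comp y.left c.hom W V hyV hV g
      rw [hg] at h3
      refine (show y.eval V hyV f = _ from h3).trans ?_
      refine Eq.trans ?_ h'
      simp only [c.Spec_map_complexHom]
    have hxa : c.complexHom x a ≠ 0 := by
      intro h0
      apply ha
      rw [← c.Spec_map_complexHom]
      change c.complexHom x a ∈ IsLocalRing.maximalIdeal ℂ
      rw [h0]
      exact zero_mem _
    refine ⟨{y | c.complexHom y a ≠ 0 ∧ c.complexHom y b / c.complexHom y a ∈ O}, ?_, ?_, ?_⟩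
    · rintro y ⟨hy, hyO⟩
      obtain ⟨h, h'⟩ := hval y hy
      exact ⟨h, h' ▸ hyO⟩
    · have h0 : IsOpen[τ] {y | c.complexHom y a ≠ 0} :=
        isOpen_ne.preimage (hcont a)
      have h1 : @ContinuousOn _ _ τ _ (fun y => c.complexHom y b / c.complexHom y a)
          {y | c.complexHom y a ≠ 0} :=
        (hcont b).continuousOn.div (hcont a).continuousOn fun y hy => hy
      exact h1.isOpen_inter_preimage h0 hO
    · obtain ⟨h, h'⟩ := hval x hxa
      exact ⟨hxa, h' ▸ hxO⟩

/-- The algebra homomorphism `a ↦ a(x)` attached to a real point `x`. -/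
def realHom (x : RealPoints X) : A →ₐ[ℝ] ℝ :=
  realify (c.complexHom x.toComplex) fun a => by rw [← c.complexHom_conjAct, x.conjAct_toComplex]

theorem coe_realHom (x : RealPoints X) (a : A) : (c.realHom x a : ℂ) = c.complexHom x.toComplex a :=
  coe_realify _ _ a

theorem realHom_injective : Function.Injective c.realHom := by
  intro x y h
  refine RealPoints.toComplex_injective (c.complexHom_injective ?_)
  ext a
  rw [← c.coe_realHom, ← c.coe_realHom, h]

theorem isInducing_realHom :
    IsInducing (fun (x : RealPoints X) (a : A) => c.realHom x a) := by
  have h1 : IsInducing (Pi.map fun (_ : A) (t : ℝ) => (t : ℂ)) :=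
    IsInducing.piMap fun _ => Complex.isometry_ofReal.isEmbedding.isInducing
  have h2 : IsInducing (RealPoints.toComplex (X := X)) := RealPoints.isInducing_toComplex
  rw [← h1.of_comp_iff]
  convert c.isInducing_complexHom.comp h2 using 1
  funext x a
  exact c.coe_realHom x a

theorem kerPoint_realHom_mem (x : RealPoints X) : kerPoint (c.realHom x) ∈ Set.range c.hom := by
  refine ⟨x.toComplex.left pointC, ?_⟩
  rw [← Scheme.Hom.comp_apply, ← c.Spec_map_complexHom]
  refine PrimeSpectrum.ext (Ideal.ext fun a => ?_)
  change c.complexHom x.toComplex a ∈ IsLocalRing.maximalIdeal ℂ ↔ c.realHom x a = 0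
  rw [← c.coe_realHom, IsLocalRing.maximalIdeal_eq_bot]
  simp

/-- Composing with `ℝ → ℂ` gives a complex point supported at the kernel of `φ`. Its conjugate has
the same values, hence is the same point. -/
theorem exists_realHom (φ : A →ₐ[ℝ] ℝ) (h : kerPoint φ ∈ Set.range c.hom) :
    ∃ x, c.realHom x = φ := by
  obtain ⟨x, hx⟩ := c.exists_complexHom ((Algebra.ofId ℝ ℂ).comp φ) (by
    rintro _ ⟨(p : PrimeSpectrum ℂ), rfl⟩
    suffices hp : Spec.map (CommRingCat.ofHom ((Algebra.ofId ℝ ℂ).comp φ).toRingHom) p =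
        kerPoint φ from hp ▸ h
    refine PrimeSpectrum.ext (Ideal.ext fun a => ?_)
    change (((φ : A →ₐ[ℝ] ℝ) a : ℝ) : ℂ) ∈ p.asIdeal ↔ φ a = 0
    rw [(Ideal.eq_bot_or_top p.asIdeal).resolve_right p.2.ne_top]
    simp)
  have hx' : ∀ a, c.complexHom x a = φ a := fun a => by rw [hx]; rfl
  have hx2 : x.conjAct = x := c.complexHom_injective (by
    ext a
    rw [c.complexHom_conjAct, hx', Complex.conj_ofReal])
  refine ⟨⟨x, hx2⟩, ?_⟩
  ext a
  have h3 := c.coe_realHom (X := X) ⟨x, hx2⟩ a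
  exact_mod_cast h3.trans (hx' a)

/-- Only generators of `A` matter for the topology on the real points. -/
theorem isInducing_of_adjoin {ι : Type} (g : ι → A) (hg : Algebra.adjoin ℝ (Set.range g) = ⊤) :
    IsInducing (fun (x : RealPoints X) (i : ι) => c.realHom x (g i)) := by
  refine ⟨le_antisymm ?_ ?_⟩
  · rw [← continuous_iff_le_induced]
    exact continuous_pi fun i => (continuous_apply (g i)).comp c.isInducing_realHom.continuous
  · rw [c.isInducing_realHom.eq_induced, ← continuous_iff_le_induced]
    let τ := TopologicalSpace.induced (fun (x : RealPoints X) (i : ι) => c.realHom x (g i))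
      inferInstance
    have hτ : Continuous[τ, _] fun (x : RealPoints X) (i : ι) => c.realHom x (g i) :=
      continuous_induced_dom
    refine continuous_pi fun a => ?_
    have ha : a ∈ Algebra.adjoin ℝ (Set.range g) := hg ▸ Algebra.mem_top
    induction ha using Algebra.adjoin_induction with
    | mem y hy =>
      obtain ⟨i, rfl⟩ := hy
      exact (continuous_apply i).comp hτ
    | algebraMap t => simpa using continuous_const
    | add y z _ _ hy hz => exact (Continuous.add hy hz).congr fun x => (map_add _ _ _).symm
    | mul y z _ _ hy hz => exact (Continuous.mul hy hz).congr fun x => (map_mul _ _ _).symm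

end SpecChart

/-- Compatibility of evaluation at real points with morphisms. -/
theorem SpecChart.realHom_map {X X' : Over SpecR} {A A' : Type} [CommRing A] [Algebra ℝ A]
    [CommRing A'] [Algebra ℝ A'] (c : SpecChart X A) (c' : SpecChart X' A') (f : X ⟶ X')
    (φ : A' →ₐ[ℝ] A)
    (h : Over.Hom.left f ≫ c'.hom = c.hom ≫ Spec.map (CommRingCat.ofHom φ.toRingHom))
    (x : RealPoints X) : c'.realHom (RealPoints.map f x) = (c.realHom x).comp φ := by
  have h1 : Spec.map (CommRingCat.ofHom (c'.complexHom (RealPoints.map f x).toComplex).toRingHom) =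
      Spec.map (CommRingCat.ofHom φ.toRingHom ≫
        CommRingCat.ofHom (c.complexHom x.toComplex).toRingHom) := by
    rw [Spec.map_comp, c'.Spec_map_complexHom, c.Spec_map_complexHom, Category.assoc, ← h,
      RealPoints.left_map, Category.assoc]
  ext a
  have h2 := congrArg (fun f => f.hom a) (Spec.map_injective h1)
  have h3 : c'.complexHom (RealPoints.map f x).toComplex a = c.complexHom x.toComplex (φ a) := h2
  rw [← c'.coe_realHom, ← c.coe_realHom] at h3
  exact_mod_cast h3

/-! ### The ring of invariants for `n = 2` -/

/-- The inclusion of `B(r; 𝔸²)` into the spectrum of the ring of invariants. -/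
def chartB (r : ℕ) : SpecChart (B r 2) (Invariants r 2) where
  hom := (BOpens r 2).ι
  isOpenImmersion := inferInstanceAs (IsOpenImmersion (BOpens r 2).ι)
  comp_structure := rfl

/-- The affine scheme `Y(r)` as the spectrum of its coordinate ring. -/
def chartY (r : ℕ) : SpecChart (Y r) (RRing r) where
  hom := 𝟙 (Spec (CommRingCat.of (RRing r)))
  isOpenImmersion := inferInstanceAs (IsOpenImmersion (𝟙 (Spec (CommRingCat.of (RRing r)))))
  comp_structure := Category.id_comp _

/-- The coordinate `x_{k0} + x_{k1}`. -/
def sumVar {r : ℕ} (k : Fin r) : CoordRing r 2 := MvPolynomial.X (k, 0) + MvPolynomial.X (k, 1)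

/-- The coordinate `x_{k0} - x_{k1}`. -/
def diffVar {r : ℕ} (k : Fin r) : CoordRing r 2 := MvPolynomial.X (k, 0) - MvPolynomial.X (k, 1)

theorem perm_fin_two (σ : Equiv.Perm (Fin 2)) : σ = 1 ∨ σ = Equiv.swap 0 1 := by
  revert σ
  decide

theorem swap_smul_X {r : ℕ} (k : Fin r) (i : Fin 2) :
    Equiv.swap (0 : Fin 2) 1 • (MvPolynomial.X (k, i) : CoordRing r 2) =
      MvPolynomial.X (k, Equiv.swap 0 1 i) := by
  rw [perm_smul_def, MvPolynomial.rename_X]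
  rfl

theorem swap_smul_sumVar {r : ℕ} (k : Fin r) :
    Equiv.swap (0 : Fin 2) 1 • (sumVar k : CoordRing r 2) = sumVar k := by
  simp [sumVar, smul_add, swap_smul_X, add_comm]

theorem swap_smul_diffVar {r : ℕ} (k : Fin r) :
    Equiv.swap (0 : Fin 2) 1 • (diffVar k : CoordRing r 2) = -diffVar k := by
  simp [diffVar, smul_sub, swap_smul_X]

theorem mem_invariants {r : ℕ} {p : CoordRing r 2} :
    p ∈ Invariants r 2 ↔ Equiv.swap (0 : Fin 2) 1 • p = p := by
  refine ⟨fun h => h _, fun h σ => ?_⟩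
  rcases perm_fin_two σ with rfl | rfl
  · exact one_smul _ p
  · exact h

theorem swap_smul_swap_smul {r : ℕ} (p : CoordRing r 2) :
    Equiv.swap (0 : Fin 2) 1 • Equiv.swap (0 : Fin 2) 1 • p = p := by
  rw [smul_smul, Equiv.swap_mul_self, one_smul]

/-- The invariant `x_{k0} + x_{k1}`. -/
def sumInv {r : ℕ} (k : Fin r) : Invariants r 2 :=
  ⟨sumVar k, mem_invariants.mpr (swap_smul_sumVar k)⟩

/-- The invariant `(x_{i0} - x_{i1}) (x_{j0} - x_{j1})`. -/
def diffInv {r : ℕ} (i j : Fin r) : Invariants r 2 :=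
  ⟨diffVar i * diffVar j, mem_invariants.mpr (by
    rw [smul_mul', swap_smul_diffVar, swap_smul_diffVar, neg_mul_neg])⟩

theorem diffInv_mul_diffInv {r : ℕ} (i j k l : Fin r) :
    diffInv i j * diffInv k l = diffInv i k * diffInv j l :=
  Subtype.ext (mul_mul_mul_comm _ _ _ _)

/-- Generators of the ring of invariants. -/
def invGen (r : ℕ) : Fin r ⊕ (Fin r × Fin r) → Invariants r 2 :=
  Sum.elim sumInv fun ij => diffInv ij.1 ij.2

/-- The differences generate everything over `E` as a module together with `1`: each variable is a
combination of `sumVar k ∈ E` and `diffVar k`, and a product of two differences falls back into `E`.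
-/
theorem exists_add_sum_mul_diffVar {r : ℕ} (E : Subalgebra ℝ (CoordRing r 2))
    (hs : ∀ k, sumVar k ∈ E) (hd : ∀ i j, diffVar i * diffVar j ∈ E) (p : CoordRing r 2) :
    ∃ a ∈ E, ∃ b : Fin r → CoordRing r 2, (∀ i, b i ∈ E) ∧ p = a + ∑ i, b i * diffVar i := by
  induction p using MvPolynomial.induction_on with
  | C t => exact ⟨_, E.algebraMap_mem t, 0, fun _ => zero_mem _, by simp⟩
  | add p q hp hq =>
    obtain ⟨a, ha, b, hb, rfl⟩ := hp
    obtain ⟨a', ha', b', hb', rfl⟩ := hq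
    refine ⟨a + a', add_mem ha ha', b + b', fun i => add_mem (hb i) (hb' i), ?_⟩
    simp only [Pi.add_apply, add_mul, Finset.sum_add_distrib]
    ring
  | mul_X p ki hp =>
    obtain ⟨a, ha, b, hb, rfl⟩ := hp
    obtain ⟨k, i⟩ := ki
    obtain ⟨ε, hε⟩ : ∃ ε : ℝ, (MvPolynomial.X (k, i) : CoordRing r 2) =
        MvPolynomial.C (1 / 2) * sumVar k + MvPolynomial.C ε * diffVar k := by
      have h2 : (MvPolynomial.C (1 / 2) * 2 : CoordRing r 2) = 1 := by
        rw [show (2 : CoordRing r 2) = MvPolynomial.C 2 from (map_ofNat _ 2).symm, ← map_mul]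
        norm_num
      fin_cases i
      · refine ⟨1 / 2, ?_⟩
        simp only [sumVar, diffVar, Fin.zero_eta]
        linear_combination (-MvPolynomial.X (k, 0)) * h2
      · refine ⟨-(1 / 2), ?_⟩
        simp only [sumVar, diffVar, Fin.mk_one, map_neg]
        linear_combination (-MvPolynomial.X (k, 1)) * h2
    have hC : ∀ t : ℝ, (MvPolynomial.C t : CoordRing r 2) ∈ E := E.algebraMap_mem
    -- Multiplying by `diffVar k` sends the linear part into the constant part and the constant part
    -- `a` into the `k`-th coefficient.
    refine ⟨MvPolynomial.C (1 / 2) * sumVar k * a +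
      ∑ i, MvPolynomial.C ε * b i * (diffVar i * diffVar k),
      add_mem (mul_mem (mul_mem (hC _) (hs k)) ha)
        (sum_mem fun i _ => mul_mem (mul_mem (hC _) (hb i)) (hd i k)),
      fun i => MvPolynomial.C (1 / 2) * sumVar k * b i +
        if i = k then MvPolynomial.C ε * a else 0, fun i => ?_, ?_⟩
    · refine add_mem (mul_mem (mul_mem (hC _) (hs k)) (hb i)) ?_
      split_ifs
      · exact mul_mem (hC _) ha
      · exact zero_mem _
    · simp only [hε, add_mul, Finset.sum_add_distrib, ite_mul, zero_mul, Finset.sum_ite_eq',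
        Finset.mem_univ, if_true, mul_add, Finset.sum_mul]
      have h1 : ∑ i, b i * diffVar i * (MvPolynomial.C (1 / 2) * sumVar k) =
          ∑ i, MvPolynomial.C (1 / 2) * sumVar k * b i * diffVar i :=
        Finset.sum_congr rfl fun i _ => by ring
      have h2 : ∑ i, b i * diffVar i * (MvPolynomial.C ε * diffVar k) =
          ∑ i, MvPolynomial.C ε * b i * (diffVar i * diffVar k) :=
        Finset.sum_congr rfl fun i _ => by ring
      rw [h1, h2]
      ring

/-- The swap fixes the even part `a` and negates the odd part, so an invariant element equals its
even part, 2 being invertible. -/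
theorem adjoin_invGen (r : ℕ) : Algebra.adjoin ℝ (Set.range (invGen r)) = ⊤ := by
  rw [eq_top_iff]
  rintro p -
  let E := (Algebra.adjoin ℝ (Set.range (invGen r))).map (Invariants r 2).val
  have hgen : ∀ i, (invGen r i : CoordRing r 2) ∈ E := fun i =>
    ⟨_, Algebra.subset_adjoin ⟨i, rfl⟩, rfl⟩
  obtain ⟨a, ha, b, hb, hp⟩ := exists_add_sum_mul_diffVar E (fun k => hgen (Sum.inl k))
    (fun i j => hgen (Sum.inr (i, j))) p
  have hfix : ∀ e ∈ E, Equiv.swap (0 : Fin 2) 1 • e = e := by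
    rintro _ ⟨e, -, rfl⟩
    exact e.2 _
  have h1 : (p : CoordRing r 2) = a - ∑ i, b i * diffVar i := by
    rw [← p.2 (Equiv.swap 0 1), hp, smul_add, hfix a ha, Finset.smul_sum, sub_eq_add_neg,
      ← Finset.sum_neg_distrib]
    congr 1
    refine Finset.sum_congr rfl fun i _ => ?_
    rw [smul_mul', hfix _ (hb i), swap_smul_diffVar, mul_neg]
  have h2 : (p : CoordRing r 2) = a := by
    have h3 : (2 : ℝ) • (p : CoordRing r 2) = (2 : ℝ) • a := by
      rw [two_smul, two_smul]
      linear_combination hp + h1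
    exact smul_right_injective _ (two_ne_zero (α := ℝ)) h3
  obtain ⟨e, he, hea⟩ := ha
  rwa [← show e = p from Subtype.ext (hea.trans h2.symm)]

theorem coordToS_sumVar {r : ℕ} (k : Fin r) : coordToS r (sumVar k) = 0 := by
  simp [coordToS, sumVar]

theorem coordToS_diffVar {r : ℕ} (k : Fin r) : coordToS r (diffVar k) = z k := by
  simp only [coordToS, diffVar, map_sub, MvPolynomial.aeval_X]
  simp only [if_true, one_ne_zero, if_false, sub_neg_eq_add, ← add_smul]
  norm_num

theorem coordToS_surjective (r : ℕ) : Function.Surjective (coordToS r) := by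
  intro s
  obtain ⟨q, rfl⟩ := Ideal.Quotient.mk_surjective s
  refine ⟨MvPolynomial.aeval diffVar q, ?_⟩
  have h : (coordToS r).comp (MvPolynomial.aeval diffVar) = toS r :=
    MvPolynomial.algHom_ext fun i => by simp [coordToS_diffVar, z]
  exact DFunLike.congr_fun h q

/-- Averaging over the group of order two turns any preimage of an invariant into an invariant
preimage. -/
theorem invToR_surjective (r : ℕ) : Function.Surjective (invToR r) := by
  intro y
  obtain ⟨p, hp⟩ := coordToS_surjective r y.1
  have hy : negS r y.1 = y.1 := y.2
  refine ⟨⟨(1 / 2 : ℝ) • (p + Equiv.swap (0 : Fin 2) 1 • p), mem_invariants.mpr ?_⟩, ?_⟩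
  · rw [smul_comm, smul_add, swap_smul_swap_smul, add_comm]
  · refine Subtype.ext ?_
    change coordToS r ((1 / 2 : ℝ) • (p + Equiv.swap (0 : Fin 2) 1 • p)) = y.1
    rw [map_smul, map_add, ← negS_coordToS, hp, hy, ← two_smul ℝ, smul_smul]
    norm_num

theorem YToBScheme_comp_ι (r : ℕ) : YToBScheme r ≫ (BOpens r 2).ι = YToQuot r :=
  IsOpenImmersion.lift_fac _ _ _

/-- Surjectivity on rings makes the map to the whole affine quotient a closed immersion, and this
passes to the factor landing in the open subscheme. -/
theorem isClosedImmersion_YToB (r : ℕ) : IsClosedImmersion (YToB r).left := by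
  have h1 : IsClosedImmersion (YToQuot r) :=
    IsClosedImmersion.spec_of_surjective _ (invToR_surjective r)
  rw [← YToBScheme_comp_ι] at h1
  exact IsClosedImmersion.of_comp (YToBScheme r) (BOpens r 2).ι

theorem realHom_map_YToB {r : ℕ} (x : RealPoints (Y r)) :
    (chartB r).realHom (RealPoints.map (YToB r) x) = ((chartY r).realHom x).comp (invToR r) :=
  (chartY r).realHom_map (chartB r) (YToB r) (invToR r)
    ((YToBScheme_comp_ι r).trans (Category.id_comp _).symm) x

/-- Primes of the invariant ring lift to the polynomial ring by integrality, and a prime contains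
the square of a difference exactly when it contains the difference. -/
theorem kerPoint_mem_BOpens {r : ℕ} (φ : Invariants r 2 →ₐ[ℝ] ℝ) :
    kerPoint φ ∈ Set.range (chartB r).hom ↔ ∃ k, φ (diffInv k k) ≠ 0 := by
  have h0 : Set.range (chartB r).hom = (BOpens r 2 : Set _) := Scheme.Opens.range_ι _
  rw [h0]
  constructor
  · rintro ⟨p, hp, hpφ⟩
    obtain ⟨k, hk⟩ := (mem_Uset p).mp hp 0 1 (by decide)
    refine ⟨k, fun h => hk ?_⟩
    have h1 : diffInv k k ∈ (kerPoint φ).asIdeal := h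
    rw [← show _ = kerPoint φ from hpφ] at h1
    have h2 : diffVar k * diffVar k ∈ PrimeSpectrum.asIdeal p := h1
    exact (p.2.mem_or_mem h2).elim id id
  · rintro ⟨k, hk⟩
    have hint : Algebra.IsIntegral (Invariants r 2) (CoordRing r 2) :=
      Algebra.IsInvariant.isIntegral (Invariants r 2) (CoordRing r 2) (Equiv.Perm (Fin 2))
    obtain ⟨Q, -, hQ, hQφ⟩ := Ideal.exists_ideal_over_prime_of_isIntegral
      (S := CoordRing r 2) (kerPoint φ).asIdeal ⊥ (by
        intro x hx
        have hx0 : algebraMap (Invariants r 2) (CoordRing r 2) x = 0 := by simpa using hx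
        rw [show x = 0 from Subtype.ext hx0]
        exact zero_mem _)
    refine ⟨⟨Q, hQ⟩, (mem_Uset _).mpr fun i j hij => ⟨k, fun hmem => hk ?_⟩, PrimeSpectrum.ext hQφ⟩
    obtain rfl : i = 0 := by omega
    obtain rfl : j = 1 := by omega
    have h1 : diffInv k k ∈ Q.comap (algebraMap (Invariants r 2) (CoordRing r 2)) :=
      Q.mul_mem_left (diffVar k) hmem
    rw [hQφ] at h1
    exact h1

/-! ### Coordinates on the real points of `B(r; 𝔸²)` -/

/-- The coordinates of a real point of `B(r; 𝔸²)`: the vector of the `x_{k0} + x_{k1}` and the matrix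
of the `(x_{i0} - x_{i1}) (x_{j0} - x_{j1})`. -/
def bCoord {r : ℕ} (x : RealPoints (B r 2)) : (Fin r → ℝ) × (Fin r → Fin r → ℝ) :=
  (fun k => (chartB r).realHom x (sumInv k), fun i j => (chartB r).realHom x (diffInv i j))

theorem invHom_ext {r : ℕ} {T : Type} [CommRing T] [Algebra ℝ T] {φ ψ : Invariants r 2 →ₐ[ℝ] T}
    (h1 : ∀ k, φ (sumInv k) = ψ (sumInv k)) (h2 : ∀ i j, φ (diffInv i j) = ψ (diffInv i j)) :
    φ = ψ := by
  refine AlgHom.ext_of_adjoin_eq_top (adjoin_invGen r) ?_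
  rintro _ ⟨k | ⟨i, j⟩, rfl⟩
  · exact h1 k
  · exact h2 i j

theorem bCoord_injective (r : ℕ) : Function.Injective (bCoord (r := r)) := by
  intro x y h
  refine (chartB r).realHom_injective (invHom_ext (fun k => ?_) fun i j => ?_)
  · exact congrFun (congrArg Prod.fst h) k
  · exact congrFun (congrFun (congrArg Prod.snd h) i) j

theorem continuous_realHom {X : Over SpecR} {A : Type} [CommRing A] [Algebra ℝ A]
    (c : SpecChart X A) (a : A) : Continuous fun x : RealPoints X => c.realHom x a :=
  (continuous_apply a).comp c.isInducing_realHom.continuous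

theorem continuous_bCoord (r : ℕ) : Continuous (bCoord (r := r)) :=
  (continuous_pi fun _ => continuous_realHom _ _).prodMk
    (continuous_pi fun _ => continuous_pi fun _ => continuous_realHom _ _)

/-- The coordinates as a single family indexed by the generators of the ring of invariants. -/
def coordFamily {r : ℕ} (m : (Fin r → ℝ) × (Fin r → Fin r → ℝ)) : Fin r ⊕ (Fin r × Fin r) → ℝ :=
  Sum.elim m.1 fun ij => m.2 ij.1 ij.2

theorem continuous_coordFamily (r : ℕ) : Continuous (coordFamily (r := r)) := by
  refine continuous_pi ?_
  rintro (k | ⟨i, j⟩)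
  · exact (continuous_apply k).comp continuous_fst
  · exact (continuous_apply j).comp ((continuous_apply i).comp continuous_snd)

theorem coordFamily_bCoord {r : ℕ} (x : RealPoints (B r 2)) (g : Fin r ⊕ (Fin r × Fin r)) :
    coordFamily (bCoord x) g = (chartB r).realHom x (invGen r g) := by
  rcases g with k | ⟨i, j⟩ <;> rfl

theorem isEmbedding_bCoord (r : ℕ) : IsEmbedding (bCoord (r := r)) := by
  refine ⟨IsInducing.of_comp (continuous_bCoord r) (continuous_coordFamily r) ?_,
    bCoord_injective r⟩
  convert (chartB r).isInducing_of_adjoin _ (adjoin_invGen r) using 1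
  funext x g
  exact coordFamily_bCoord x g

/-- Evaluation of polynomials at `x_{k0} = (w_k + δ v_k) / 2`, `x_{k1} = (w_k - δ v_k) / 2`. -/
def evalAt {r : ℕ} (w v : Fin r → ℝ) (δ : ℂ) : CoordRing r 2 →ₐ[ℝ] ℂ :=
  MvPolynomial.aeval fun ki : Fin r × Fin 2 =>
    if ki.2 = 0 then ((w ki.1 : ℂ) + δ * v ki.1) / 2 else ((w ki.1 : ℂ) - δ * v ki.1) / 2

theorem evalAt_sumVar {r : ℕ} (w v : Fin r → ℝ) (δ : ℂ) (k : Fin r) :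
    evalAt w v δ (sumVar k) = w k := by
  simp [evalAt, sumVar]
  ring

theorem evalAt_diffVar {r : ℕ} (w v : Fin r → ℝ) (δ : ℂ) (k : Fin r) :
    evalAt w v δ (diffVar k) = δ * v k := by
  simp [evalAt, diffVar]
  ring

theorem exists_bCoord_eq {r : ℕ} (w v : Fin r → ℝ) (hv : v ≠ 0) (ε : ℝ) (hε : ε = 1 ∨ ε = -1) :
    ∃ x : RealPoints (B r 2), bCoord x = (w, fun i j => ε * (v i * v j)) := by
  -- For `ε = -1` this is `δ = i`: the coordinates of the point upstairs are not real, but its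
  -- values on invariants are.
  obtain ⟨δ, hδ⟩ : ∃ δ : ℂ, δ * δ = (ε : ℂ) := by
    rcases hε with rfl | rfl
    · exact ⟨1, by simp⟩
    · exact ⟨Complex.I, by simp⟩
  let φ : Invariants r 2 →ₐ[ℝ] ℂ := (evalAt w v δ).comp (Invariants r 2).val
  have hs : ∀ k, φ (sumInv k) = w k := fun k => evalAt_sumVar w v δ k
  have hd : ∀ i j, φ (diffInv i j) = (ε * (v i * v j) : ℝ) := fun i j => by
    refine (map_mul (evalAt w v δ) (diffVar i) (diffVar j)).trans ?_
    rw [evalAt_diffVar, evalAt_diffVar]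
    push_cast
    rw [← hδ]
    ring
  have hconj : (Complex.conjAe : ℂ →ₐ[ℝ] ℂ).comp φ = φ := invHom_ext
    (fun k => by
      rw [AlgHom.comp_apply, hs]
      exact Complex.conj_ofReal _)
    (fun i j => by
      rw [AlgHom.comp_apply, hd]
      exact Complex.conj_ofReal _)
  have hfix : ∀ a, (starRingEnd ℂ) (φ a) = φ a := fun a => DFunLike.congr_fun hconj a
  let ψ := realify φ hfix
  have hs' : ∀ k, ψ (sumInv k) = w k := fun k => by
    have h := (coe_realify φ hfix _).trans (hs k)
    exact_mod_cast h
  have hd' : ∀ i j, ψ (diffInv i j) = ε * (v i * v j) := fun i j => by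
    have h := (coe_realify φ hfix _).trans (hd i j)
    exact_mod_cast h
  obtain ⟨k, hk⟩ := Function.ne_iff.mp hv
  obtain ⟨x, hx⟩ := (chartB r).exists_realHom ψ ((kerPoint_mem_BOpens ψ).mpr ⟨k, by
    rw [hd']
    have hε0 : ε ≠ 0 := by rcases hε with rfl | rfl <;> norm_num
    exact mul_ne_zero hε0 (mul_ne_zero hk hk)⟩)
  refine ⟨x, Prod.ext (funext fun k => ?_) (funext fun i => funext fun j => ?_)⟩
  · exact (DFunLike.congr_fun hx _).trans (hs' k)
  · exact (DFunLike.congr_fun hx _).trans (hd' i j)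

/-- The matrix satisfies `M_{ij} M_{kk} = M_{ik} M_{jk}`. With `M_{kk} ≠ 0`, take for `v` the `k`-th
column divided by `√|M_{kk}|`, and for `ε` the sign of `M_{kk}`. -/
theorem exists_bCoord_snd {r : ℕ} (x : RealPoints (B r 2)) :
    ∃ (ε : ℝ) (v : Fin r → ℝ), (ε = 1 ∨ ε = -1) ∧ v ≠ 0 ∧
      (bCoord x).2 = fun i j => ε * (v i * v j) := by
  obtain ⟨k, hk⟩ := (kerPoint_mem_BOpens _).mp ((chartB r).kerPoint_realHom_mem x)
  set φ := (chartB r).realHom x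
  set m := φ (diffInv k k)
  have habs : 0 < |m| := abs_pos.mpr hk
  have hsq : √|m| * √|m| = |m| := Real.mul_self_sqrt habs.le
  have hsq0 : √|m| ≠ 0 := (Real.sqrt_pos.mpr habs).ne'
  have hrel : ∀ i j, φ (diffInv i j) * m = φ (diffInv i k) * φ (diffInv j k) := fun i j => by
    rw [← map_mul, ← map_mul, diffInv_mul_diffInv]
  have key : ∀ ε : ℝ, ε * |m| = m → ε * ε = 1 → ∀ i j, φ (diffInv i j) =
      ε * (φ (diffInv i k) / √|m| * (φ (diffInv j k) / √|m|)) := fun ε h1 h2 i j => by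
    rw [div_mul_div_comm, hsq, ← hrel, mul_div_assoc', eq_div_iff habs.ne']
    linear_combination φ (diffInv i j) * ε * h1 - φ (diffInv i j) * |m| * h2
  refine ⟨SignType.sign m, fun i => φ (diffInv i k) / √|m|, ?_, ?_, ?_⟩
  · rcases lt_or_gt_of_ne hk with h | h
    · right; simp [m, h]
    · left; simp [m, h]
  · exact fun h => div_ne_zero hk hsq0 (congrFun h k)
  · funext i j
    refine key _ (sign_mul_abs m) ?_ i j
    rcases lt_or_gt_of_ne hk with h | h
    · simp [m, h]
    · simp [m, h]

/-- The trace of the matrix coordinate. -/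
def trCoord {r : ℕ} (x : RealPoints (B r 2)) : ℝ := ∑ k, (bCoord x).2 k k

theorem continuous_trCoord (r : ℕ) : Continuous (trCoord (r := r)) :=
  continuous_finsetSum _ fun k _ => (continuous_apply k).comp ((continuous_apply k).comp
    (continuous_snd.comp (continuous_bCoord r)))

theorem sum_mul_self_pos {r : ℕ} {v : Fin r → ℝ} (hv : v ≠ 0) : 0 < ∑ k, v k * v k := by
  obtain ⟨k, hk⟩ := Function.ne_iff.mp hv
  exact Finset.sum_pos' (fun i _ => mul_self_nonneg _) ⟨k, Finset.mem_univ k, mul_self_pos.mpr hk⟩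

theorem trCoord_eq {r : ℕ} {x : RealPoints (B r 2)} {ε : ℝ} {v : Fin r → ℝ}
    (h : (bCoord x).2 = fun i j => ε * (v i * v j)) : trCoord x = ε * ∑ k, v k * v k := by
  simp [trCoord, h, Finset.mul_sum]

theorem trCoord_ne_zero {r : ℕ} (x : RealPoints (B r 2)) : trCoord x ≠ 0 := by
  obtain ⟨ε, v, hε, hv, h⟩ := exists_bCoord_snd x
  rw [trCoord_eq h]
  refine mul_ne_zero ?_ (sum_mul_self_pos hv).ne'
  rcases hε with rfl | rfl <;> norm_num

theorem exists_of_sign_trCoord {r : ℕ} {ε : ℝ} (hε : ε = 1 ∨ ε = -1) {x : RealPoints (B r 2)}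
    (hx : 0 < ε * trCoord x) :
    ∃ v : Fin r → ℝ, v ≠ 0 ∧ (bCoord x).2 = fun i j => ε * (v i * v j) := by
  obtain ⟨ε', v, hε', hv, h⟩ := exists_bCoord_snd x
  have hpos := sum_mul_self_pos hv
  rw [trCoord_eq h] at hx
  obtain rfl : ε' = ε := by
    rcases hε with rfl | rfl <;> rcases hε' with rfl | rfl
    · rfl
    · linarith
    · linarith
    · rfl
  exact ⟨v, hv, h⟩

/-! ### The image of the real points of `Y(r)` -/

/-- Since `invToR` is surjective, the images of the generators of the invariant ring generate `RRing
r`, so the same coordinates determine both the points and the topology of `Y(r)(ℝ)`. -/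
theorem isEmbedding_map_YToB (r : ℕ) : IsEmbedding (RealPoints.map (YToB r)) := by
  have hadj : Algebra.adjoin ℝ (Set.range (invToR r ∘ invGen r)) = ⊤ := by
    rw [Set.range_comp, ← AlgHom.map_adjoin, adjoin_invGen, Algebra.map_top,
      AlgHom.range_eq_top]
    exact invToR_surjective r
  have hcomp : ∀ y g, coordFamily (bCoord (RealPoints.map (YToB r) y)) g =
      (chartY r).realHom y ((invToR r ∘ invGen r) g) := fun y g => by
    rw [coordFamily_bCoord, realHom_map_YToB]
    rfl
  have hind : IsInducing fun y => coordFamily (bCoord (RealPoints.map (YToB r) y)) := by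
    convert (chartY r).isInducing_of_adjoin _ hadj using 1
    funext y g
    exact hcomp y g
  have hcont : Continuous (RealPoints.map (YToB r)) := by
    rw [((chartB r).isInducing_of_adjoin _ (adjoin_invGen r)).continuous_iff]
    convert hind.continuous using 1
    funext y g
    exact (coordFamily_bCoord _ g).symm
  refine ⟨IsInducing.of_comp hcont ((continuous_coordFamily r).comp (continuous_bCoord r)) hind, ?_⟩
  intro y y' h
  refine (chartY r).realHom_injective (AlgHom.ext_of_adjoin_eq_top hadj ?_)
  rintro _ ⟨g, rfl⟩
  rw [← hcomp, ← hcomp, h]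

theorem bCoord_map_fst {r : ℕ} (y : RealPoints (Y r)) :
    (bCoord (RealPoints.map (YToB r) y)).1 = 0 := by
  funext k
  change (chartB r).realHom _ (sumInv k) = 0
  rw [realHom_map_YToB, AlgHom.comp_apply,
    show invToR r (sumInv k) = 0 from Subtype.ext (coordToS_sumVar k), map_zero]

theorem coe_invToR_diffInv {r : ℕ} (i j : Fin r) :
    (invToR r (diffInv i j) : SRing r) = z i * z j := by
  refine (map_mul (coordToS r) (diffVar i) (diffVar j)).trans ?_
  rw [coordToS_diffVar, coordToS_diffVar]

theorem trCoord_map {r : ℕ} (y : RealPoints (Y r)) :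
    trCoord (RealPoints.map (YToB r) y) = 1 := by
  change ∑ k, (chartB r).realHom _ (diffInv k k) = 1
  rw [← map_sum, realHom_map_YToB, AlgHom.comp_apply]
  have h : invToR r (∑ k, diffInv k k) = 1 := by
    refine Subtype.ext ?_
    rw [map_sum, AddSubmonoidClass.coe_finsetSum]
    simp only [coe_invToR_diffInv, ← sq]
    exact sum_z_sq r
  rw [h, map_one]

/-- The real point of `Spec S` with coordinates `v`. -/
def evalS {r : ℕ} (v : Fin r → ℝ) (hv : ∑ k, v k * v k = 1) : SRing r →ₐ[ℝ] ℝ :=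
  Ideal.Quotient.liftₐ
    (Ideal.span {(∑ i : Fin r, MvPolynomial.X i ^ 2 - 1 : MvPolynomial (Fin r) ℝ)})
    (MvPolynomial.aeval v) (by
    intro a ha
    have hle : Ideal.span {(∑ i : Fin r, MvPolynomial.X i ^ 2 - 1 : MvPolynomial (Fin r) ℝ)} ≤
        RingHom.ker (MvPolynomial.aeval (R := ℝ) v) := by
      rw [Ideal.span_singleton_le_iff_mem, RingHom.mem_ker]
      simp [sq, hv]
    exact hle ha)

theorem evalS_z {r : ℕ} (v : Fin r → ℝ) (hv : ∑ k, v k * v k = 1) (i : Fin r) :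
    evalS v hv (z i) = v i :=
  MvPolynomial.aeval_X _ i

theorem exists_bCoord_map_eq {r : ℕ} (v : Fin r → ℝ) (hv : ∑ k, v k * v k = 1) :
    ∃ y : RealPoints (Y r), bCoord (RealPoints.map (YToB r) y) = (0, fun i j => v i * v j) := by
  -- The chart of `Y(r)` is the identity, so every point lies in its range.
  obtain ⟨y, hy⟩ := (chartY r).exists_realHom ((evalS v hv).comp (RRing r).val) ⟨_, rfl⟩
  refine ⟨y, Prod.ext (bCoord_map_fst y) (funext fun i => funext fun j => ?_)⟩
  change (chartB r).realHom _ (diffInv i j) = _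
  rw [realHom_map_YToB, AlgHom.comp_apply, hy, AlgHom.comp_apply]
  change evalS v hv (invToR r (diffInv i j) : SRing r) = _
  rw [coe_invToR_diffInv, map_mul, evalS_z, evalS_z]

/-- Trace one excludes `ε = -1` and makes `v` a unit vector, that is, a real point of `Spec S`. -/
theorem mem_range_map_YToB {r : ℕ} (x : RealPoints (B r 2)) :
    x ∈ Set.range (RealPoints.map (YToB r)) ↔ (bCoord x).1 = 0 ∧ trCoord x = 1 := by
  constructor
  · rintro ⟨y, rfl⟩
    exact ⟨bCoord_map_fst y, trCoord_map y⟩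
  · rintro ⟨h1, h2⟩
    obtain ⟨v, hv, h⟩ := exists_of_sign_trCoord (Or.inl rfl) (x := x) (by rw [h2]; norm_num)
    obtain ⟨y, hy⟩ := exists_bCoord_map_eq v (by rw [← h2, trCoord_eq h, one_mul])
    refine ⟨y, bCoord_injective r (hy.trans (Prod.ext h1.symm ?_))⟩
    simp [h]

theorem isClosedEmbedding_map_YToB (r : ℕ) : IsClosedEmbedding (RealPoints.map (YToB r)) := by
  refine ⟨isEmbedding_map_YToB r, ?_⟩
  have h : Set.range (RealPoints.map (YToB r)) =
      {x | (bCoord x).1 = 0} ∩ {x | trCoord x = 1} := Set.ext mem_range_map_YToB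
  rw [h]
  exact (isClosed_eq (continuous_fst.comp (continuous_bCoord r)) continuous_const).inter
    (isClosed_eq (continuous_trCoord r) continuous_const)

/-! ### Real projective space -/

/-- The line spanned by a nonzero vector. -/
def RealProj.mk {r : ℕ} (v : {v : Fin r → ℝ // v ≠ 0}) : RealProj r :=
  Quotient.mk (projectivizationSetoid ℝ (Fin r → ℝ)) v

theorem RealProj.mk_surjective (r : ℕ) : Function.Surjective (RealProj.mk (r := r)) :=
  Quotient.mk_surjective

theorem RealProj.isQuotientMap_mk (r : ℕ) : IsQuotientMap (RealProj.mk (r := r)) :=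
  isQuotientMap_quot_mk

theorem RealProj.mk_eq_mk {r : ℕ} {v w : {v : Fin r → ℝ // v ≠ 0}} :
    RealProj.mk v = RealProj.mk w ↔ ∃ a : ℝ, a • (w : Fin r → ℝ) = v := by
  refine Iff.trans (b := Projectivization.mk ℝ v.1 v.2 = Projectivization.mk ℝ w.1 w.2) Iff.rfl ?_
  exact Projectivization.mk_eq_mk_iff' ℝ _ _ _ _

/-- The orthogonal projection onto the line spanned by `v`, as a matrix. -/
def projOf {r : ℕ} (v : Fin r → ℝ) : Fin r → Fin r → ℝ := fun i j =>
  v i * v j / ∑ k, v k * v k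

theorem projOf_smul {r : ℕ} {a : ℝ} (ha : a ≠ 0) (v : Fin r → ℝ) : projOf (a • v) = projOf v := by
  funext i j
  have h : ∑ k, (a • v) k * (a • v) k = a * a * ∑ k, v k * v k := by
    rw [Finset.mul_sum]
    exact Finset.sum_congr rfl fun k _ => by simp only [Pi.smul_apply, smul_eq_mul]; ring
  rw [projOf, h]
  simp only [Pi.smul_apply, smul_eq_mul]
  rw [mul_mul_mul_comm, mul_div_mul_left _ _ (mul_ne_zero ha ha), projOf]

/-- The matrix of the orthogonal projection onto a line. -/
def RealProj.matrix {r : ℕ} (p : RealProj r) : Fin r → Fin r → ℝ :=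
  Quotient.lift (s := projectivizationSetoid ℝ (Fin r → ℝ))
    (fun v : {v : Fin r → ℝ // v ≠ 0} => projOf (v : Fin r → ℝ)) (by
      intro v w h
      obtain ⟨a, ha⟩ := RealProj.mk_eq_mk.mp (Quotient.sound h : RealProj.mk v = RealProj.mk w)
      have ha0 : a ≠ 0 := by
        rintro rfl
        exact v.2 (by rw [← ha, zero_smul])
      simp only [← ha, projOf_smul ha0]) p

theorem RealProj.matrix_mk {r : ℕ} (v : {v : Fin r → ℝ // v ≠ 0}) :
    (RealProj.mk v).matrix = projOf v.1 := rfl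

theorem RealProj.continuous_matrix (r : ℕ) : Continuous (RealProj.matrix (r := r)) := by
  rw [(RealProj.isQuotientMap_mk r).continuous_iff]
  refine continuous_pi fun i => continuous_pi fun j => ?_
  have h : ∀ k, Continuous fun v : {v : Fin r → ℝ // v ≠ 0} => (v : Fin r → ℝ) k := fun k =>
    (continuous_apply k).comp continuous_subtype_val
  exact ((h i).mul (h j)).div (continuous_finsetSum _ fun k _ => (h k).mul (h k))
    fun v => (sum_mul_self_pos v.2).ne'

theorem RealProj.exists_unit {r : ℕ} (p : RealProj r) :
    ∃ v : {v : Fin r → ℝ // v ≠ 0}, ∑ k, v.1 k * v.1 k = 1 ∧ RealProj.mk v = p := by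
  obtain ⟨v, rfl⟩ := RealProj.mk_surjective r p
  have hpos := sum_mul_self_pos v.2
  have hsq := Real.mul_self_sqrt hpos.le
  set s := √(∑ k, v.1 k * v.1 k)
  have hs : s ≠ 0 := (Real.sqrt_pos.mpr hpos).ne'
  refine ⟨⟨s⁻¹ • v.1, smul_ne_zero (inv_ne_zero hs) v.2⟩, ?_, RealProj.mk_eq_mk.mpr ⟨_, rfl⟩⟩
  have h : ∑ k, (s⁻¹ • v.1) k * (s⁻¹ • v.1) k = s⁻¹ * s⁻¹ * ∑ k, v.1 k * v.1 k := by
    rw [Finset.mul_sum]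
    exact Finset.sum_congr rfl fun k _ => by simp only [Pi.smul_apply, smul_eq_mul]; ring
  rw [h, ← hsq]
  field_simp

theorem projOf_of_unit {r : ℕ} {v : Fin r → ℝ} (hv : ∑ k, v k * v k = 1) :
    projOf v = fun i j => v i * v j := by
  funext i j
  rw [projOf, hv, div_one]

/-- For unit vectors with `v vᵀ = w wᵀ`, applying both matrices to `v` gives `v = (v · w) w`. -/
theorem RealProj.matrix_injective (r : ℕ) : Function.Injective (RealProj.matrix (r := r)) := by
  intro p q h
  obtain ⟨v, hv, rfl⟩ := p.exists_unit
  obtain ⟨w, hw, rfl⟩ := q.exists_unit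
  rw [RealProj.matrix_mk, RealProj.matrix_mk, projOf_of_unit hv, projOf_of_unit hw] at h
  refine RealProj.mk_eq_mk.mpr ⟨∑ k, v.1 k * w.1 k, funext fun i => ?_⟩
  have hik : ∀ k, v.1 i * v.1 k = w.1 i * w.1 k := fun k => congrFun (congrFun h i) k
  calc (∑ k, v.1 k * w.1 k) * w.1 i = ∑ k, (w.1 i * w.1 k) * v.1 k := by
        rw [Finset.sum_mul]
        exact Finset.sum_congr rfl fun k _ => by ring
    _ = ∑ k, v.1 i * (v.1 k * v.1 k) :=
        Finset.sum_congr rfl fun k _ => by rw [← hik]; ring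
    _ = v.1 i := by rw [← Finset.mul_sum, hv, mul_one]

theorem RealProj.trace_matrix {r : ℕ} (p : RealProj r) : ∑ k, p.matrix k k = 1 := by
  obtain ⟨v, hv, rfl⟩ := p.exists_unit
  rw [RealProj.matrix_mk, projOf_of_unit hv, hv]

theorem isCompact_unit_vectors (r : ℕ) : IsCompact {v : Fin r → ℝ | ∑ k, v k * v k = 1} := by
  refine Metric.isCompact_of_isClosed_isBounded ?_ ?_
  · exact isClosed_eq (continuous_finsetSum _ fun k _ =>
      (continuous_apply k).mul (continuous_apply k)) continuous_const
  · refine Metric.isBounded_closedBall (x := (0 : Fin r → ℝ)) (r := 1) |>.subset fun v hv => ?_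
    rw [mem_closedBall_zero_iff, pi_norm_le_iff_of_nonneg zero_le_one]
    intro k
    rw [Real.norm_eq_abs, abs_le_one_iff_mul_self_le_one]
    rw [← show ∑ k, v k * v k = 1 from hv]
    exact Finset.single_le_sum (f := fun k => v k * v k) (fun i _ => mul_self_nonneg _)
      (Finset.mem_univ k)

instance (r : ℕ) : CompactSpace (RealProj r) := by
  have hc := isCompact_iff_compactSpace.mp (isCompact_unit_vectors r)
  let f : {v : Fin r → ℝ | ∑ k, v k * v k = 1} → RealProj r := fun v =>
    RealProj.mk ⟨v.1, fun h => by simpa [h] using v.2⟩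
  have hf : Continuous f := (RealProj.isQuotientMap_mk r).continuous.comp
    (continuous_subtype_val.subtype_mk _)
  have hsurj : Function.Surjective f := fun p => by
    obtain ⟨v, hv, rfl⟩ := p.exists_unit
    exact ⟨⟨v.1, hv⟩, rfl⟩
  exact hsurj.compactSpace hf

instance (r : ℕ) : T2Space (RealPoints (B r 2)) := (isEmbedding_bCoord r).t2Space

/-- The projection matrix of a line gives a continuous bijection from the compact space `ℝP^{r-1}`
to a Hausdorff space. -/
theorem nonempty_homeomorph_realPoints_Y (r : ℕ) : Nonempty (RealPoints (Y r) ≃ₜ RealProj r) := by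
  have hex : ∀ p : RealProj r, ∃ y : RealPoints (Y r),
      bCoord (RealPoints.map (YToB r) y) = (0, p.matrix) := fun p => by
    obtain ⟨v, hv, rfl⟩ := p.exists_unit
    rw [RealProj.matrix_mk, projOf_of_unit hv]
    exact exists_bCoord_map_eq v.1 hv
  choose f hf using hex
  have hemb := (isEmbedding_bCoord r).comp (isEmbedding_map_YToB r)
  have hcont : Continuous f := by
    rw [hemb.isInducing.continuous_iff]
    convert continuous_const.prodMk (RealProj.continuous_matrix r) using 1
    exact funext hf
  have hinj : Function.Injective f := fun p q h =>
    RealProj.matrix_injective r <| congrArg (Prod.snd (α := Fin r → ℝ)) <|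
      (hf p).symm.trans ((congrArg (fun y => bCoord (RealPoints.map (YToB r) y)) h).trans (hf q))
  have hsurj : Function.Surjective f := fun y => by
    have ht := trCoord_map y
    obtain ⟨v, hv, h⟩ := exists_of_sign_trCoord (Or.inl rfl)
      (x := RealPoints.map (YToB r) y) (by rw [ht]; norm_num)
    rw [trCoord_eq h, one_mul] at ht
    refine ⟨RealProj.mk ⟨v, hv⟩, hemb.injective ((hf _).trans (Prod.ext ?_ ?_))⟩
    · exact (bCoord_map_fst y).symm
    · rw [RealProj.matrix_mk, projOf_of_unit ht]
      simp [h]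
  have : T2Space (RealPoints (Y r)) := hemb.t2Space
  exact ⟨(hcont.homeoOfEquivCompactToT2 (f := Equiv.ofBijective f ⟨hinj, hsurj⟩)).symm⟩

/-! ### The deformation of `B(r; 𝔸²)(ℝ)` -/

/-- Scaling `M` by `s > 0` amounts to scaling `v` by `√s`, so it stays within the same sign. -/
theorem exists_bCoord_eq_smul {r : ℕ} (x : RealPoints (B r 2)) (w : Fin r → ℝ) {s : ℝ}
    (hs : 0 < s) : ∃ y : RealPoints (B r 2), bCoord y = (w, s • (bCoord x).2) := by
  obtain ⟨ε, v, hε, hv, h⟩ := exists_bCoord_snd x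
  obtain ⟨y, hy⟩ := exists_bCoord_eq w (√s • v)
    (smul_ne_zero (Real.sqrt_pos.mpr hs).ne' hv) ε hε
  refine ⟨y, hy.trans (Prod.ext rfl (funext fun i => funext fun j => ?_))⟩
  simp only [h, Pi.smul_apply, smul_eq_mul]
  linear_combination ε * v i * v j * Real.mul_self_sqrt hs.le

/-- The factor by which the deformation scales the matrix coordinate. -/
def scaleFactor {r : ℕ} (t : unitInterval) (x : RealPoints (B r 2)) : ℝ :=
  (1 - (t : ℝ) + t * |trCoord x|)⁻¹

theorem scaleFactor_aux {r : ℕ} (t : unitInterval) (x : RealPoints (B r 2)) :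
    0 < 1 - (t : ℝ) + t * |trCoord x| := by
  have h := abs_pos.mpr (trCoord_ne_zero x)
  rcases t.2.1.eq_or_lt with h0 | h0
  · rw [← h0]
    norm_num
  · exact add_pos_of_nonneg_of_pos (sub_nonneg.mpr t.2.2) (mul_pos h0 h)

theorem scaleFactor_pos {r : ℕ} (t : unitInterval) (x : RealPoints (B r 2)) :
    0 < scaleFactor t x := inv_pos.mpr (scaleFactor_aux t x)

/-- The deformation `(w, M) ↦ ((1 - t) w, M / ((1 - t) + t |tr M|))`. -/
def deform {r : ℕ} (t : unitInterval) (x : RealPoints (B r 2)) : RealPoints (B r 2) :=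
  (exists_bCoord_eq_smul x ((1 - (t : ℝ)) • (bCoord x).1) (scaleFactor_pos t x)).choose

theorem bCoord_deform {r : ℕ} (t : unitInterval) (x : RealPoints (B r 2)) :
    bCoord (deform t x) = ((1 - (t : ℝ)) • (bCoord x).1, scaleFactor t x • (bCoord x).2) :=
  (exists_bCoord_eq_smul x ((1 - (t : ℝ)) • (bCoord x).1) (scaleFactor_pos t x)).choose_spec

/-- The choice in `deform` is harmless: its coordinates are given by a continuous formula, and the
coordinates are an embedding. -/
theorem continuous_deform (r : ℕ) :
    Continuous fun p : unitInterval × RealPoints (B r 2) => deform p.1 p.2 := by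
  rw [(isEmbedding_bCoord r).isInducing.continuous_iff]
  have ht : Continuous fun p : unitInterval × RealPoints (B r 2) => (p.1 : ℝ) :=
    continuous_subtype_val.comp continuous_fst
  have hx := (continuous_bCoord r).comp (continuous_snd (X := unitInterval))
  have htr := (continuous_trCoord r).comp (continuous_snd (X := unitInterval))
  have hs : Continuous fun p : unitInterval × RealPoints (B r 2) => scaleFactor p.1 p.2 :=
    ((continuous_const.sub ht).add (ht.mul htr.abs)).inv₀ fun p => (scaleFactor_aux p.1 p.2).ne'
  convert ((continuous_const.sub ht).smul (continuous_fst.comp hx)).prodMk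
    (hs.smul (continuous_snd.comp hx)) using 1
  exact funext fun p => bCoord_deform p.1 p.2

theorem trCoord_deform {r : ℕ} (t : unitInterval) (x : RealPoints (B r 2)) :
    trCoord (deform t x) = scaleFactor t x * trCoord x := by
  simp [trCoord, bCoord_deform, Finset.mul_sum]

theorem deform_zero {r : ℕ} (x : RealPoints (B r 2)) : deform 0 x = x :=
  bCoord_injective r ((bCoord_deform 0 x).trans (by simp [scaleFactor]))

theorem deform_eq_self {r : ℕ} {x : RealPoints (B r 2)} (h1 : (bCoord x).1 = 0)
    (h2 : |trCoord x| = 1) (t : unitInterval) : deform t x = x := by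
  refine bCoord_injective r ((bCoord_deform t x).trans ?_)
  rw [scaleFactor, h2, h1, smul_zero, mul_one, sub_add_cancel, inv_one, one_smul, ← h1]

theorem bCoord_deform_one_fst {r : ℕ} (x : RealPoints (B r 2)) : (bCoord (deform 1 x)).1 = 0 := by
  simp [bCoord_deform]

theorem trCoord_deform_one {r : ℕ} (x : RealPoints (B r 2)) :
    trCoord (deform 1 x) = |trCoord x|⁻¹ * trCoord x := by
  simp [trCoord_deform, scaleFactor]

theorem abs_trCoord_deform_one {r : ℕ} (x : RealPoints (B r 2)) : |trCoord (deform 1 x)| = 1 := by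
  rw [trCoord_deform_one, abs_mul, abs_inv, abs_abs,
    inv_mul_cancel₀ (abs_pos.mpr (trCoord_ne_zero x)).ne']

/-! ### Connected components -/

/-- The part of `B(r; 𝔸²)(ℝ)` on which the trace has the sign `ε`. -/
def signPart (r : ℕ) (ε : ℝ) : Set (RealPoints (B r 2)) := {x | 0 < ε * trCoord x}

/-- As the trace never vanishes, the strict inequality agrees with the weak one. -/
theorem isClopen_signPart (r : ℕ) {ε : ℝ} (hε : ε = 1 ∨ ε = -1) : IsClopen (signPart r ε) := by
  have hε0 : ε ≠ 0 := by rcases hε with rfl | rfl <;> norm_num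
  have hc : Continuous fun x : RealPoints (B r 2) => ε * trCoord x :=
    continuous_const.mul (continuous_trCoord r)
  refine ⟨?_, isOpen_lt continuous_const hc⟩
  convert isClosed_le continuous_const hc using 1
  ext x
  exact ⟨fun h => le_of_lt (show 0 < ε * trCoord x from h),
    fun h => lt_of_le_of_ne h (mul_ne_zero hε0 (trCoord_ne_zero x)).symm⟩

/-- If a point of the segment were zero, pairing it with `v` and with `w` would give vanishing sums
of nonnegative terms, forcing both `t = 1` and `t = 0`. -/
theorem segment_ne_zero {r : ℕ} {v w : Fin r → ℝ} (hv : v ≠ 0) (hw : w ≠ 0)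
    (h : 0 ≤ ∑ k, v k * w k) (t : unitInterval) : (1 - (t : ℝ)) • v + (t : ℝ) • w ≠ 0 := by
  intro h0
  have hv' := sum_mul_self_pos hv
  have hw' := sum_mul_self_pos hw
  have ht0 := t.2.1
  have ht1 := t.2.2
  have hk : ∀ k, (1 - (t : ℝ)) * v k + t * w k = 0 := fun k => congrFun h0 k
  have h1 : (1 - (t : ℝ)) * ∑ k, v k * v k + t * ∑ k, v k * w k = 0 := by
    rw [Finset.mul_sum, Finset.mul_sum, ← Finset.sum_add_distrib]
    exact Finset.sum_eq_zero fun k _ => by linear_combination v k * hk k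
  have h2 : (1 - (t : ℝ)) * ∑ k, v k * w k + t * ∑ k, w k * w k = 0 := by
    rw [Finset.mul_sum, Finset.mul_sum, ← Finset.sum_add_distrib]
    exact Finset.sum_eq_zero fun k _ => by linear_combination w k * hk k
  have h3 := mul_nonneg ht0 h
  have h4 := mul_nonneg (sub_nonneg.mpr ht1) h
  have h5 := mul_nonneg (sub_nonneg.mpr ht1) hv'.le
  have h6 := mul_nonneg ht0 hw'.le
  have h7 : 1 - (t : ℝ) = 0 := by
    refine (mul_eq_zero.mp (?_ : (1 - (t : ℝ)) * ∑ k, v k * v k = 0)).resolve_right hv'.ne'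
    linarith
  have h8 : (t : ℝ) = 0 := by
    refine (mul_eq_zero.mp (?_ : (t : ℝ) * ∑ k, w k * w k = 0)).resolve_right hw'.ne'
    linarith
  linarith

theorem isPreconnected_signPart (r : ℕ) {ε : ℝ} (hε : ε = 1 ∨ ε = -1) :
    IsPreconnected (signPart r ε) := by
  have hεε : ε * ε = 1 := by rcases hε with rfl | rfl <;> norm_num
  refine isPreconnected_of_forall_pair fun x hx y hy => ?_
  obtain ⟨v, hv, hxv⟩ := exists_of_sign_trCoord hε hx
  obtain ⟨w, hw, hyw, hvw⟩ : ∃ w : Fin r → ℝ, w ≠ 0 ∧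
      ((bCoord y).2 = fun i j => ε * (w i * w j)) ∧ 0 ≤ ∑ k, v k * w k := by
    obtain ⟨w, hw, hyw⟩ := exists_of_sign_trCoord hε hy
    -- The vectors `w` and `-w` define the same matrix, so the inner product with `v` may be assumed
    -- nonnegative.
    rcases le_total 0 (∑ k, v k * w k) with h | h
    · exact ⟨w, hw, hyw, h⟩
    · exact ⟨-w, neg_ne_zero.mpr hw, by simpa using hyw, by simpa using h⟩
  have hex : ∀ t : unitInterval, ∃ p : RealPoints (B r 2), bCoord p =
      ((1 - (t : ℝ)) • (bCoord x).1 + (t : ℝ) • (bCoord y).1, fun i j =>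
        ε * (((1 - (t : ℝ)) • v + (t : ℝ) • w) i * ((1 - (t : ℝ)) • v + (t : ℝ) • w) j)) :=
    fun t => exists_bCoord_eq _ _ (segment_ne_zero hv hw hvw t) ε hε
  choose γ hγ using hex
  have hcont : Continuous γ := by
    rw [(isEmbedding_bCoord r).isInducing.continuous_iff,
      show bCoord ∘ γ = _ from funext hγ]
    simp only [Pi.add_apply, Pi.smul_apply]
    fun_prop
  refine ⟨Set.range γ, ?_, ⟨0, bCoord_injective r ?_⟩, ⟨1, bCoord_injective r ?_⟩,
    isPreconnected_range hcont⟩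
  · rintro _ ⟨t, rfl⟩
    change 0 < ε * trCoord (γ t)
    rw [trCoord_eq (congrArg Prod.snd (hγ t)), ← mul_assoc, hεε, one_mul]
    exact sum_mul_self_pos (segment_ne_zero hv hw hvw t)
  · rw [hγ]
    exact Prod.ext (by simp) (by simp [hxv])
  · rw [hγ]
    exact Prod.ext (by simp) (by simp [hyw])

theorem connectedComponent_eq_signPart {r : ℕ} {ε : ℝ} (hε : ε = 1 ∨ ε = -1)
    {x : RealPoints (B r 2)} (hx : x ∈ signPart r ε) : connectedComponent x = signPart r ε :=
  ((isClopen_signPart r hε).connectedComponent_subset hx).antisymm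
    ((isPreconnected_signPart r hε).subset_connectedComponent hx)

theorem exists_mem_signPart {r : ℕ} (hr : 1 ≤ r) {ε : ℝ} (hε : ε = 1 ∨ ε = -1) :
    (signPart r ε).Nonempty := by
  -- Here `1 ≤ r` enters: without a coordinate there is no nonzero vector.
  have hv : (fun _ => 1 : Fin r → ℝ) ≠ 0 := fun h => one_ne_zero (congrFun h ⟨0, hr⟩)
  obtain ⟨x, hx⟩ := exists_bCoord_eq 0 _ hv ε hε
  refine ⟨x, ?_⟩
  change 0 < ε * trCoord x
  rw [trCoord_eq (congrArg Prod.snd hx), ← mul_assoc,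
    show ε * ε = 1 by rcases hε with rfl | rfl <;> norm_num, one_mul]
  exact sum_mul_self_pos hv

theorem card_connectedComponents (r : ℕ) (hr : 1 ≤ r) :
    Nat.card (ConnectedComponents (RealPoints (B r 2))) = 2 := by
  obtain ⟨x, hx⟩ := exists_mem_signPart hr (Or.inl rfl)
  obtain ⟨y, hy⟩ := exists_mem_signPart hr (Or.inr rfl)
  have hx' := connectedComponent_eq_signPart (Or.inl rfl) hx
  have hy' := connectedComponent_eq_signPart (Or.inr rfl) hy
  rw [Nat.card_eq_two_iff]
  refine ⟨x, y, fun h => ?_, Set.eq_univ_of_forall fun c => ?_⟩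
  · rw [ConnectedComponents.coe_eq_coe, hx', hy'] at h
    have h1 : 0 < 1 * trCoord x := hx
    have h2 : 0 < -1 * trCoord x := h.subset hx
    linarith
  · obtain ⟨p, rfl⟩ := ConnectedComponents.surjective_coe c
    rcases lt_or_gt_of_ne (trCoord_ne_zero p) with h | h
    · have hp : p ∈ signPart r (-1) := by
        change 0 < -1 * trCoord p
        linarith
      right
      exact ConnectedComponents.coe_eq_coe.mpr
        ((connectedComponent_eq_signPart (Or.inr rfl) hp).trans hy'.symm)
    · have hp : p ∈ signPart r 1 := by
        change 0 < 1 * trCoord p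
        linarith
      left
      exact ConnectedComponents.coe_eq_coe.mpr
        ((connectedComponent_eq_signPart (Or.inl rfl) hp).trans hx'.symm)

theorem deform_mem_signPart {r : ℕ} {ε : ℝ} {x : RealPoints (B r 2)} (hx : x ∈ signPart r ε)
    (t : unitInterval) : deform t x ∈ signPart r ε := by
  change 0 < ε * trCoord (deform t x)
  rw [trCoord_deform, mul_left_comm]
  exact mul_pos (scaleFactor_pos t x) hx

/-- `deform` preserves the sign of the trace, and on the positive part it ends at `w = 0` and trace
one, fixing such points throughout. -/
theorem isDeformationRetract_signPart (r : ℕ) :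
    IsDeformationRetract (Set.range (RealPoints.map (YToB r))) (signPart r 1) := by
  refine ⟨fun x hx => ?_, ⟨fun p => ⟨deform p.1 p.2.1, deform_mem_signPart p.2.2 p.1⟩, ?_⟩,
    fun x => Subtype.ext (deform_zero x.1), fun x => ?_, fun t x hx => Subtype.ext ?_⟩
  · change 0 < 1 * trCoord x
    rw [((mem_range_map_YToB x).mp hx).2]
    norm_num
  · exact ((continuous_deform r).comp
      (continuous_fst.prodMk (continuous_subtype_val.comp continuous_snd))).subtype_mk _
  · refine (mem_range_map_YToB _).mpr ⟨bCoord_deform_one_fst _, ?_⟩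
    have hx : 0 < 1 * trCoord x.1 := x.2
    rw [one_mul] at hx
    exact (trCoord_deform_one x.1).trans (by rw [abs_of_pos hx, inv_mul_cancel₀ hx.ne'])
  · obtain ⟨h1, h2⟩ := (mem_range_map_YToB _).mp hx
    exact deform_eq_self h1 (by rw [h2, abs_one]) t

/-! ### The homotopy type -/

/-- The two copies are the lines `p` sent to `(0, P)` and `(0, -P)`, with `P` the projection matrix
of `p`. Traces `1` and `-1` keep them disjoint, and compactness turns the continuous injection into
an embedding. -/
theorem exists_isEmbedding_sum (r : ℕ) :
    ∃ g : RealProj r ⊕ RealProj r → RealPoints (B r 2), IsEmbedding g ∧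
      ∀ x, x ∈ Set.range g ↔ (bCoord x).1 = 0 ∧ |trCoord x| = 1 := by
  have hex : ∀ (ε : ℝ), (ε = 1 ∨ ε = -1) → ∀ p : RealProj r, ∃ x : RealPoints (B r 2),
      bCoord x = (0, ε • p.matrix) := fun ε hε p => by
    obtain ⟨v, hv, rfl⟩ := p.exists_unit
    rw [RealProj.matrix_mk, projOf_of_unit hv]
    exact exists_bCoord_eq 0 v.1 v.2 ε hε
  have htr : ∀ (ε : ℝ) (p : RealProj r) (x : RealPoints (B r 2)),
      bCoord x = (0, ε • p.matrix) → trCoord x = ε := fun ε p x h => by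
    simp [trCoord, h, ← Finset.mul_sum, p.trace_matrix]
  have hsurj : ∀ (ε : ℝ), (ε = 1 ∨ ε = -1) → ∀ x : RealPoints (B r 2), (bCoord x).1 = 0 →
      trCoord x = ε → ∃ p : RealProj r, bCoord x = (0, ε • p.matrix) := fun ε hε x h0 h1 => by
    have hεε : ε * ε = 1 := by rcases hε with rfl | rfl <;> norm_num
    have hε0 : ε ≠ 0 := fun h => by simp [h] at hεε
    obtain ⟨v, hv, h⟩ := exists_of_sign_trCoord hε (x := x) (by rw [h1, hεε]; norm_num)
    rw [trCoord_eq h] at h1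
    have h2 : ∑ k, v k * v k = 1 := mul_left_cancel₀ hε0 (h1.trans (mul_one ε).symm)
    refine ⟨RealProj.mk ⟨v, hv⟩, Prod.ext h0 ?_⟩
    rw [RealProj.matrix_mk, projOf_of_unit h2, h]
    rfl
  choose f hf using hex 1 (Or.inl rfl)
  choose f' hf' using hex (-1) (Or.inr rfl)
  have hcont : ∀ (ε : ℝ) (k : RealProj r → RealPoints (B r 2)),
      (∀ p, bCoord (k p) = (0, ε • p.matrix)) → Continuous k := fun ε k hk => by
    rw [(isEmbedding_bCoord r).isInducing.continuous_iff, show bCoord ∘ k = _ from funext hk]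
    exact continuous_const.prodMk ((RealProj.continuous_matrix r).const_smul ε)
  have hinj : ∀ (ε : ℝ), ε ≠ 0 → ∀ (k : RealProj r → RealPoints (B r 2)),
      (∀ p, bCoord (k p) = (0, ε • p.matrix)) → Function.Injective k := fun ε hε k hk p q h => by
    have h1 := congrArg Prod.snd ((hk p).symm.trans ((congrArg bCoord h).trans (hk q)))
    exact RealProj.matrix_injective r (smul_right_injective _ hε h1)
  refine ⟨Sum.elim f f', ?_, fun x => ⟨?_, fun ⟨h0, h1⟩ => ?_⟩⟩
  · refine (Continuous.isClosedEmbedding ((hcont 1 f hf).sumElim (hcont (-1) f' hf'))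
      (Function.Injective.sumElim (hinj 1 one_ne_zero f hf)
        (hinj (-1) (by norm_num) f' hf') fun p q h => ?_)).isEmbedding
    have h1 := htr 1 p _ (hf p)
    have h2 := htr (-1) q _ (hf' q)
    rw [h, h2] at h1
    norm_num at h1
  · rintro ⟨p | p, rfl⟩
    · exact ⟨congrArg Prod.fst (hf p), by simp [htr 1 p _ (hf p)]⟩
    · exact ⟨congrArg Prod.fst (hf' p), by simp [htr (-1) p _ (hf' p)]⟩
  · rcases eq_or_eq_neg_of_abs_eq h1 with h | h
    · obtain ⟨p, hp⟩ := hsurj 1 (Or.inl rfl) x h0 h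
      exact ⟨Sum.inl p, bCoord_injective r ((hf p).trans hp.symm)⟩
    · obtain ⟨p, hp⟩ := hsurj (-1) (Or.inr rfl) x h0 h
      exact ⟨Sum.inr p, bCoord_injective r ((hf' p).trans hp.symm)⟩

theorem nonempty_homotopyEquiv (r : ℕ) :
    Nonempty (ContinuousMap.HomotopyEquiv (RealPoints (B r 2)) (RealProj r ⊕ RealProj r)) := by
  obtain ⟨g, hg, hrange⟩ := exists_isEmbedding_sum r
  have hmem : ∀ x, deform 1 x ∈ Set.range g := fun x =>
    (hrange _).mpr ⟨bCoord_deform_one_fst x, abs_trCoord_deform_one x⟩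
  let ρ : C(RealPoints (B r 2), Set.range g) := ⟨fun x => ⟨deform 1 x, hmem x⟩,
    ((continuous_deform r).comp (continuous_const.prodMk continuous_id)).subtype_mk _⟩
  let ι : C(Set.range g, RealPoints (B r 2)) := ⟨Subtype.val, continuous_subtype_val⟩
  have hleft : (ContinuousMap.id _).Homotopic (ι.comp ρ) :=
    ⟨⟨⟨fun p => deform p.1 p.2, continuous_deform r⟩, fun x => deform_zero x, fun x => rfl⟩⟩
  have hright : ρ.comp ι = ContinuousMap.id _ := by
    refine ContinuousMap.ext fun x => ?_
    obtain ⟨h1, h2⟩ := (hrange _).mp x.2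
    exact Subtype.ext (deform_eq_self h1 h2 1)
  let e : ContinuousMap.HomotopyEquiv (RealPoints (B r 2)) (Set.range g) :=
    ⟨ρ, ι, hleft.symm, hright ▸ ContinuousMap.Homotopic.refl _⟩
  exact ⟨e.trans hg.toHomeomorph.symm.toHomotopyEquiv⟩

end EtaleClassifying

end

theorem proposition7p5 (r : ℕ) (hr : 1 ≤ r) :
    Nonempty (ContinuousMap.HomotopyEquiv (EtaleClassifying.RealPoints (EtaleClassifying.B r 2))
      (EtaleClassifying.RealProj r ⊕ EtaleClassifying.RealProj r)) ∧
    Nat.card (ConnectedComponents (EtaleClassifying.RealPoints (EtaleClassifying.B r 2))) = 2 ∧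
    IsClosedImmersion (EtaleClassifying.YToB r).left ∧
    Nonempty (EtaleClassifying.RealPoints (EtaleClassifying.Y r) ≃ₜ EtaleClassifying.RealProj r) ∧
    Topology.IsClosedEmbedding (EtaleClassifying.RealPoints.map (EtaleClassifying.YToB r)) ∧
    ∃ b : EtaleClassifying.RealPoints (EtaleClassifying.B r 2),
      EtaleClassifying.IsDeformationRetract
        (Set.range (EtaleClassifying.RealPoints.map (EtaleClassifying.YToB r)))
        (connectedComponent b) := by
  -- Any point of positive trace serves, as its component is the whole positive part.
  obtain ⟨b, hb⟩ := EtaleClassifying.exists_mem_signPart hr (Or.inl rfl)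
  refine ⟨EtaleClassifying.nonempty_homotopyEquiv r,
    EtaleClassifying.card_connectedComponents r hr, EtaleClassifying.isClosedImmersion_YToB r,
    EtaleClassifying.nonempty_homeomorph_realPoints_Y r,
    EtaleClassifying.isClosedEmbedding_map_YToB r, b, ?_⟩
  rw [EtaleClassifying.connectedComponent_eq_signPart (Or.inl rfl) hb]
  exact EtaleClassifying.isDeformationRetract_signPart r
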